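/- Let $\Phi$ be the standard normal distribution function and let $\varphi_\mu$ be the density of $N(\mu,1)$. For an integer $m\ge 0$ let $F_m(x)=P\{X_{m,1/2}+U\le x\}$, where $X_{m,1/2}\sim\mathrm{Bin}(m,1/2)$ and $U$ is an independent uniform variable on $[-\tfrac12,\tfrac12)$. For $p\in[0,1]$ let $$\tilde g_{m,p}(z)=\frac{d}{dz}P\{\Phi^{-1}(F_m(X_{m,p}+U))\le z\},$$ where $X_{m,p}\sim\mathrm{Bin}(m,p)$ and $U$ is an independent uniform variable on $[-\tfrac12,\tfrac12)$; this is a probability density of $\Phi^{-1}(F_m(X_{m,p}+U))$. For probability densities $f,g$ on $\mathbb R$ write $H^2(f,g)=\int_{\mathbb R}(\sqrt f-\sqrt g)^2\,dz$. There is a constant $C_1>0$ such that, for all integers $m\ge 0$ and all $p\in(0,1)$, with $b=\frac{\sqrt m}{2}\log\frac{p}{1-p}$, $$H^2(\tilde g_{m,p},\varphi_b)\le C_1\Bigl(\frac{b^2}{m}+\frac{b^8}{m^2}\Bigr)$$ (for $m=0$ the right-hand side is read as $0$). Consequently, there is a constant $D>0$ such that, for all integers $m\ge0$, all $p\in[0,1]$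 and all $\beta\in\mathbb R$, $$H^2(\tilde g_{m,p},\varphi_\beta)\le D\Bigl[\bigl(p-\tfrac12\bigr)^2+m\bigl(p-\tfrac12\bigr)^4\Bigr]+\frac{(\sqrt m(2p-1)-\beta)^2}{2}.$$ -/

import Mathlib

open MeasureTheory ProbabilityTheory

/-- The uniform distribution on the interval `[-1/2, 1/2)` (which has length one). -/
noncomputable def uniformNoise : Measure ℝ :=
  volume.restrict (Set.Ico (-(1 / 2) : ℝ) (1 / 2))

instance uniformNoise_isProbabilityMeasure : IsProbabilityMeasure uniformNoise :=
  ⟨by simp [uniformNoise]; norm_num⟩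

/-- The law of `X + U` with `X ∼ Bin(m, p)` and `U` uniform on `[-1/2, 1/2)` independent. -/
noncomputable def smoothedBinomial (m : ℕ) (p : unitInterval) : Measure ℝ :=
  ((binomial m p).prod uniformNoise).map (fun q : ℕ × ℝ => (q.1 : ℝ) + q.2)

instance smoothedBinomial_isProbabilityMeasure (m : ℕ) (p : unitInterval) :
    IsProbabilityMeasure (smoothedBinomial m p) :=
  Measure.isProbabilityMeasure_map
    (((measurable_of_countable (fun n : ℕ => (n : ℝ))).comp measurable_fst).add
      measurable_snd).aemeasurable

/-- The point `1/2` of the unit interval. -/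
noncomputable def oneHalf : unitInterval := ⟨1 / 2, by norm_num, by norm_num⟩

/-- `F_m`, the distribution function of `Bin(m, 1/2) + U`. -/
noncomputable def binomialSmoothCDF (m : ℕ) : ℝ → ℝ := cdf (smoothedBinomial m oneHalf)

/-- `Φ⁻¹`, the inverse of the standard normal distribution function `Φ` on `(0, 1)`
(the values outside `(0, 1)` are irrelevant). -/
noncomputable def stdNormalQuantile (u : ℝ) : ℝ :=
  sInf {x : ℝ | u ≤ cdf (gaussianReal 0 1) x}

/-- The random variable `Φ⁻¹(F_m(X + U))` as a function of the pair `(X, U)`. -/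
noncomputable def quantileCoupling (m : ℕ) (q : ℕ × ℝ) : ℝ :=
  stdNormalQuantile (binomialSmoothCDF m ((q.1 : ℝ) + q.2))

/-- The distribution function `z ↦ P{Φ⁻¹(F_m(X + U)) ≤ z}`, where `X ∼ Bin(m, p)` and `U` is
an independent uniform variable on `[-1/2, 1/2)`. -/
noncomputable def transformedCDF (m : ℕ) (p : unitInterval) (z : ℝ) : ℝ :=
  ((binomial m p).prod uniformNoise).real {q | quantileCoupling m q ≤ z}

/-- `g̃_{m,p}`, the density `d/dz P{Φ⁻¹(F_m(X + U)) ≤ z}`. -/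
noncomputable def transformedDensity (m : ℕ) (p : unitInterval) (z : ℝ) : ℝ :=
  deriv (transformedCDF m p) z

/-- The squared Hellinger distance `∫ (√f - √g)²` of two probability densities on the line. -/
noncomputable def hellingerSq (f g : ℝ → ℝ) : ℝ :=
  ∫ z, (√(f z) - √(g z)) ^ 2

/-! The transformation is a quantile coupling. Given `X = k`, the variable `F_m(X + U)` is uniform
between the consecutive values `fairCDF m k` and `fairCDF m (k + 1)`. Call the set of `z` with
`Φ(z)` between these values the band of `k`. For `p = 1/2` the transformed variable is exactly
standard normal, and for general `p` its density on the band of `k` is `φ(z)` times the likelihood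
ratio of `Bin(m, p)` to `Bin(m, 1/2)` at `k` (`map_quantileCoupling`).

With `t` half the log-odds, that ratio is `exp(t(2k - m) - m log cosh t)`, while `φ_b / φ_0 = exp(bz
- b²/2)` with `b = √m t`. So the log-ratio of the two densities is `L = m(t²/2 - log cosh t) + b(w -
z)`, where `w = (2k - m)/√m`. The first term lies between `0` and `m t⁴/4`. The second is controlled
by the Tusnády-type estimate `|w - z| ≤ C(1/√m + |z|³/m)` on the band of `k`
(`abs_sub_le_of_mem_band`). That estimate needs no Stirling formula: binomial and normal tails are
compared through ratios of successive increments (`le_of_increment_ratio_monotone`).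

Since `(√g - √f)² ≤ L²/4 (f + g)` when `g = f e^L`, integrating against a Gaussian envelope gives
the order `t² + m² t⁸ = b²/m + b⁸/m²`. The envelope exists when `t` and `m t⁴` are small; otherwise
the trivial bound `H² ≤ 2` suffices.

The second estimate follows by the triangle inequality through the mean `√m(2p - 1)`: with `d = 2p -
1` one has `t = artanh d = d + O(d³)`, and normal laws of unit variance satisfy `H² ≤ (difference of
means)²/4`. -/

/-! ### The standard normal law and ratios of its increments -/

/-- The standard normal distribution function. -/
noncomputable def stdNormalCDF (x : ℝ) : ℝ := cdf (gaussianReal 0 1) x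

/-- The standard normal density. -/
noncomputable abbrev stdNormalPDF : ℝ → ℝ := gaussianPDFReal 0 1

theorem gaussianPDFReal_one_eq (μ x : ℝ) :
    gaussianPDFReal μ 1 x = (√(2 * Real.pi))⁻¹ * Real.exp (-(x - μ) ^ 2 / 2) := by
  simp [gaussianPDFReal]

theorem continuous_gaussianPDFReal_one (μ : ℝ) : Continuous (gaussianPDFReal μ 1) := by
  have : gaussianPDFReal μ 1 =
      fun x => (√(2 * Real.pi))⁻¹ * Real.exp (-(x - μ) ^ 2 / 2) :=
    funext (gaussianPDFReal_one_eq μ)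
  rw [this]
  fun_prop

theorem stdNormalCDF_eq_real (x : ℝ) :
    stdNormalCDF x = (gaussianReal 0 1).real (Set.Iic x) := cdf_eq_real _ x

theorem stdNormalCDF_eq_integral (x : ℝ) :
    stdNormalCDF x = ∫ y in Set.Iic x, stdNormalPDF y := by
  rw [stdNormalCDF_eq_real, measureReal_def, gaussianReal_apply_eq_integral _ one_ne_zero,
    ENNReal.toReal_ofReal]
  exact integral_nonneg fun y => gaussianPDFReal_nonneg _ _ _

theorem stdNormalCDF_sub (a b : ℝ) :
    stdNormalCDF b - stdNormalCDF a = ∫ y in a..b, stdNormalPDF y := by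
  rw [stdNormalCDF_eq_integral, stdNormalCDF_eq_integral,
    intervalIntegral.integral_Iic_sub_Iic] <;>
  exact (integrable_gaussianPDFReal 0 1).integrableOn

theorem hasDerivAt_stdNormalCDF (x : ℝ) : HasDerivAt stdNormalCDF (stdNormalPDF x) x := by
  have h : stdNormalCDF = fun b => stdNormalCDF 0 + ∫ y in (0 : ℝ)..b, stdNormalPDF y := by
    funext b
    rw [← stdNormalCDF_sub]
    ring
  rw [h]
  exact (intervalIntegral.integral_hasDerivAt_right
    ((continuous_gaussianPDFReal_one 0).intervalIntegrable _ _)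
    (continuous_gaussianPDFReal_one 0).stronglyMeasurable.stronglyMeasurableAtFilter
    (continuous_gaussianPDFReal_one 0).continuousAt).const_add _

theorem continuous_stdNormalCDF : Continuous stdNormalCDF :=
  continuous_iff_continuousAt.2 fun x => (hasDerivAt_stdNormalCDF x).continuousAt

theorem strictMono_stdNormalCDF : StrictMono stdNormalCDF :=
  strictMono_of_deriv_pos fun x => by
    rw [(hasDerivAt_stdNormalCDF x).deriv]
    exact gaussianPDFReal_pos _ _ _ one_ne_zero

theorem stdNormalCDF_pos (x : ℝ) : 0 < stdNormalCDF x :=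
  (cdf_nonneg _ (x - 1)).trans_lt (strictMono_stdNormalCDF (by linarith))

theorem stdNormalCDF_lt_one (x : ℝ) : stdNormalCDF x < 1 :=
  (strictMono_stdNormalCDF (by linarith : x < x + 1)).trans_le (cdf_le_one _ (x + 1))

theorem stdNormalCDF_neg (x : ℝ) : stdNormalCDF (-x) = 1 - stdNormalCDF x := by
  have h : (gaussianReal 0 1).real (Set.Iic (-x)) = (gaussianReal 0 1).real (Set.Ici x) := by
    conv_lhs => rw [← neg_zero, ← gaussianReal_map_neg]
    rw [map_measureReal_apply measurable_neg measurableSet_Iic]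
    simp
  have : NullSingletonClass (gaussianReal 0 1) := nullSingletonClass_gaussianReal one_ne_zero
  rw [stdNormalCDF_eq_real, h, stdNormalCDF_eq_real, ← probReal_compl_eq_one_sub measurableSet_Iic,
    Set.compl_Iic]
  exact (measureReal_congr Ioi_ae_eq_Ici).symm

theorem stdNormalCDF_zero : stdNormalCDF 0 = 1 / 2 := by
  have := stdNormalCDF_neg 0
  rw [neg_zero] at this
  linarith

theorem one_sub_stdNormalCDF_le_exp {x : ℝ} (hx : 0 ≤ x) :
    1 - stdNormalCDF x ≤ Real.exp (-x ^ 2 / 2) := by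
  have h := measure_ge_le_exp_mul_mgf (μ := gaussianReal 0 1) (X := id) x hx
    (integrable_exp_mul_gaussianReal x)
  rw [mgf_id_gaussianReal] at h
  have h2 : 1 - stdNormalCDF x ≤ (gaussianReal 0 1).real {ω | x ≤ id ω} := by
    rw [stdNormalCDF_eq_real, ← probReal_compl_eq_one_sub measurableSet_Iic, Set.compl_Iic]
    exact measureReal_mono fun y (hy : x < y) => hy.le
  refine (h2.trans h).trans_eq ?_
  rw [← Real.exp_add]
  congr 1
  simp only [NNReal.coe_one]
  ring

theorem stdNormalPDF_add (x d : ℝ) :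
    stdNormalPDF (x + d) = stdNormalPDF x * Real.exp (-(x * d) - d ^ 2 / 2) := by
  rw [stdNormalPDF, gaussianPDFReal_one_eq, gaussianPDFReal_one_eq, mul_assoc, ← Real.exp_add]
  congr 2
  ring

theorem stdNormalPDF_le_of_le {x y : ℝ} (hx : 0 ≤ x) (hxy : x ≤ y) :
    stdNormalPDF y ≤ stdNormalPDF x := by
  rw [stdNormalPDF, gaussianPDFReal_one_eq, gaussianPDFReal_one_eq]
  gcongr

/-- Lower bound for the ratio of normal probabilities of two adjacent intervals of equal length. -/
theorem stdNormalCDF_increment_ge {a d : ℝ} (hd : 0 ≤ d) :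
    Real.exp (-((a + d) * d) - d ^ 2 / 2) * (stdNormalCDF (a + d) - stdNormalCDF a) ≤
      stdNormalCDF (a + 2 * d) - stdNormalCDF (a + d) := by
  have e : stdNormalCDF (a + 2 * d) - stdNormalCDF (a + d) =
      ∫ y in a..a + d, stdNormalPDF (y + d) := by
    rw [stdNormalCDF_sub, intervalIntegral.integral_comp_add_right]
    congr 1
    ring
  rw [e, stdNormalCDF_sub, ← intervalIntegral.integral_const_mul]
  have hc := continuous_gaussianPDFReal_one 0
  apply intervalIntegral.integral_mono_on (by linarith)
  · exact (hc.const_mul _).intervalIntegrable _ _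
  · exact (hc.comp (continuous_id.add continuous_const)).intervalIntegrable _ _
  intro x hx
  rw [stdNormalPDF_add, mul_comm]
  have := gaussianPDFReal_nonneg 0 1 x
  gcongr
  exact hx.2

/-- Upper bound for the ratio of normal probabilities of two adjacent intervals of increasing
lengths. -/
theorem stdNormalCDF_increment_le {a b c : ℝ} (ha : 0 ≤ a) (hab : a < b) (hbc : b - a ≤ c - b) :
    stdNormalCDF c - stdNormalCDF b ≤
      (c - b) / (b - a) * Real.exp (-((b ^ 2 - a ^ 2) / 2)) *
        (stdNormalCDF b - stdNormalCDF a) := by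
  set r := (c - b) / (b - a) with hr
  have hd : 0 < b - a := by linarith
  have hr1 : 1 ≤ r := by rw [hr, le_div_iff₀ hd]; linarith
  have hr0 : r ≠ 0 := by positivity
  have hrd : r * (b - a) = c - b := div_mul_cancel₀ _ hd.ne'
  -- The affine map of slope `r ≥ 1` carrying `[a, b]` onto `[b, c]` moves each point at least as
  -- far right as translation by `b - a`, and the density decreases there.
  have e : stdNormalCDF c - stdNormalCDF b =
      r * ∫ y in a..b, stdNormalPDF (r * y + (b - r * a)) := by
    rw [intervalIntegral.integral_comp_mul_add stdNormalPDF hr0, smul_eq_mul,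
      mul_inv_cancel_left₀ hr0, stdNormalCDF_sub]
    congr 1 <;> linarith
  rw [e, stdNormalCDF_sub, mul_assoc]
  have hc := continuous_gaussianPDFReal_one 0
  refine mul_le_mul_of_nonneg_left ?_ (by positivity : 0 ≤ r)
  rw [← intervalIntegral.integral_const_mul]
  apply intervalIntegral.integral_mono_on hab.le
  · exact (hc.comp ((continuous_id.const_mul _).add continuous_const)).intervalIntegrable _ _
  · exact (hc.const_mul _).intervalIntegrable _ _
  intro x hx
  have h1 : x + (b - a) ≤ r * x + (b - r * a) := by nlinarith [hx.1]
  refine (stdNormalPDF_le_of_le (by linarith [hx.1]) h1).trans ?_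
  rw [stdNormalPDF_add, mul_comm]
  have := gaussianPDFReal_nonneg 0 1 x
  gcongr
  nlinarith [hx.1]

/-! ### The normal quantile function -/

theorem stdNormalQuantile_le_iff {u : ℝ} (h0 : 0 < u) (h1 : u < 1) (z : ℝ) :
    stdNormalQuantile u ≤ z ↔ u ≤ stdNormalCDF z := by
  obtain ⟨x, hx⟩ : ∃ x, stdNormalCDF x = u := by
    have hmem := mem_range_of_exists_le_of_exists_ge continuous_stdNormalCDF (c := u)
      ((tendsto_cdf_atBot (gaussianReal 0 1)).eventually_le_const h0).exists
      ((tendsto_cdf_atTop (gaussianReal 0 1)).eventually_const_le h1).exists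
    exact hmem
  have : {y : ℝ | u ≤ cdf (gaussianReal 0 1) y} = Set.Ici x := by
    ext y
    change u ≤ stdNormalCDF y ↔ x ≤ y
    rw [← hx, strictMono_stdNormalCDF.le_iff_le]
  rw [stdNormalQuantile, this, csInf_Ici, ← hx, strictMono_stdNormalCDF.le_iff_le]

theorem stdNormalCDF_stdNormalQuantile {u : ℝ} (h0 : 0 < u) (h1 : u < 1) :
    stdNormalCDF (stdNormalQuantile u) = u := by
  apply le_antisymm
  · by_contra! h
    obtain ⟨y, hy1, hy2⟩ : ∃ y, y < stdNormalQuantile u ∧ u < stdNormalCDF y := by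
      have hev := (continuous_stdNormalCDF.tendsto (stdNormalQuantile u)).eventually_const_lt h
      obtain ⟨y, hy, hy'⟩ := ((hev.filter_mono nhdsWithin_le_nhds).and
        (self_mem_nhdsWithin (s := Set.Iio (stdNormalQuantile u)))).exists
      exact ⟨y, hy', hy⟩
    exact absurd ((stdNormalQuantile_le_iff h0 h1 y).2 hy2.le) (not_le.2 hy1)
  · exact (stdNormalQuantile_le_iff h0 h1 _).1 le_rfl

/-- Outside `(0, 1)` the set in the definition is the whole line or empty, and `sInf` takes the
default value `0` on both. Only measurability depends on this. -/
theorem stdNormalQuantile_of_notMem {u : ℝ} (h : u ∉ Set.Ioo (0 : ℝ) 1) :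
    stdNormalQuantile u = 0 := by
  rw [stdNormalQuantile]
  by_cases h0 : u ≤ 0
  · have : {x : ℝ | u ≤ cdf (gaussianReal 0 1) x} = Set.univ :=
      Set.eq_univ_of_forall fun x => h0.trans (cdf_nonneg _ x)
    rw [this, Real.sInf_univ]
  · have h1 : 1 ≤ u := by
      by_contra! h1
      exact h ⟨not_le.1 h0, h1⟩
    have : {x : ℝ | u ≤ cdf (gaussianReal 0 1) x} = ∅ :=
      Set.eq_empty_of_forall_notMem fun x hx =>
        absurd (h1.trans hx) (not_le.2 (stdNormalCDF_lt_one x))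
    rw [this, Real.sInf_empty]

theorem measurable_stdNormalQuantile : Measurable stdNormalQuantile := by
  refine measurable_of_Iic fun z => ?_
  have : stdNormalQuantile ⁻¹' Set.Iic z =
      (Set.Ioo 0 1 ∩ Set.Iic (stdNormalCDF z)) ∪ ((Set.Ioo 0 1)ᶜ ∩ {_u : ℝ | 0 ≤ z}) := by
    ext u
    by_cases hu : u ∈ Set.Ioo (0 : ℝ) 1
    · simpa [hu] using stdNormalQuantile_le_iff hu.1 hu.2 z
    · simp only [Set.mem_preimage, stdNormalQuantile_of_notMem hu, Set.mem_Iic, Set.mem_union,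
        Set.mem_inter_iff, hu, Set.mem_compl_iff, Set.mem_ofPred_eq, false_and, not_false_eq_true,
        true_and, false_or]
  rw [this]
  exact (measurableSet_Ioo.inter measurableSet_Iic).union
    (measurableSet_Ioo.compl.inter (.const _))

/-- The quantile transform: `Φ⁻¹` of a uniform variable is standard normal. -/
theorem map_stdNormalQuantile :
    (volume.restrict (Set.Ioo (0 : ℝ) 1)).map stdNormalQuantile = gaussianReal 0 1 := by
  have : IsProbabilityMeasure (volume.restrict (Set.Ioo (0 : ℝ) 1)) := ⟨by simp⟩
  have := Measure.isProbabilityMeasure_map (μ := volume.restrict (Set.Ioo (0 : ℝ) 1))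
    measurable_stdNormalQuantile.aemeasurable
  refine Measure.ext_of_Iic _ _ fun z => ?_
  rw [← ofReal_cdf (gaussianReal 0 1), Measure.map_apply measurable_stdNormalQuantile measurableSet_Iic,
    Measure.restrict_apply (measurable_stdNormalQuantile measurableSet_Iic)]
  have : stdNormalQuantile ⁻¹' Set.Iic z ∩ Set.Ioo 0 1 = Set.Ioc 0 (stdNormalCDF z) := by
    ext u
    constructor
    · rintro ⟨h, hu⟩
      exact ⟨hu.1, (stdNormalQuantile_le_iff hu.1 hu.2 z).1 h⟩
    · rintro ⟨h0, h⟩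
      have h1 := h.trans_lt (stdNormalCDF_lt_one z)
      exact ⟨(stdNormalQuantile_le_iff h0 h1 z).2 h, h0, h1⟩
  rw [this, Real.volume_Ioc, sub_zero]
  rfl

/-! ### A comparison principle for tails -/

/-- Two sequences with `τ ≤ α` at both ends of an interval and a nondecreasing ratio of the
increments of `α` to those of `τ` satisfy `τ ≤ α` throughout. -/
theorem le_of_increment_ratio_monotone {α τ : ℕ → ℝ} {k₀ k₁ : ℕ} (h₀ : τ k₀ ≤ α k₀)
    (h₁ : τ k₁ ≤ α k₁) (hpos : ∀ k, k₀ ≤ k → k < k₁ → 0 < τ k - τ (k + 1))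
    (hratio : ∀ k, k₀ ≤ k → k + 2 ≤ k₁ →
      (τ (k + 1) - τ (k + 2)) * (α k - α (k + 1)) ≤
        (τ k - τ (k + 1)) * (α (k + 1) - α (k + 2)))
    (k : ℕ) (hk₀ : k₀ ≤ k) (hk₁ : k ≤ k₁) : τ k ≤ α k := by
  by_contra! hlt
  -- If `τ` has overtaken `α` by `k`, some earlier drop of `α` exceeded that of `τ`. Monotonicity of
  -- the ratio propagates this to all later drops, so the gap cannot close before `k₁`.
  obtain ⟨l, hl₀, hlk, hl⟩ : ∃ l, k₀ ≤ l ∧ l < k ∧ τ l - τ (l + 1) < α l - α (l + 1) := by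
    by_contra! hno
    have : ∀ n, k₀ ≤ n → n ≤ k → τ n ≤ α n := by
      intro n hn
      induction n, hn using Nat.le_induction with
      | base => exact fun _ => h₀
      | succ n hn ih =>
        intro hnk
        linarith [hno n hn (by omega), ih (by omega)]
    exact absurd (this k hk₀ le_rfl) (not_le.2 hlt)
  have hinc : ∀ n, l ≤ n → n < k₁ → τ n - τ (n + 1) < α n - α (n + 1) := by
    intro n hn
    induction n, hn using Nat.le_induction with
    | base => exact fun _ => hl
    | succ n hn ih =>
      intro hnk
      have h1 := ih (by omega)
      have h2 := hratio n (by omega) (by omega)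
      have h3 := hpos n (by omega) (by omega)
      have h4 := hpos (n + 1) (by omega) (by omega)
      have h5 : (τ n - τ (n + 1)) * (τ (n + 1) - τ (n + 2)) <
          (τ n - τ (n + 1)) * (α (n + 1) - α (n + 2)) := by
        refine lt_of_lt_of_le ?_ h2
        rw [mul_comm]
        exact mul_lt_mul_of_pos_left h1 h4
      exact lt_of_mul_lt_mul_left h5 h3.le
  have hend : ∀ n, k ≤ n → n ≤ k₁ → α n - τ n ≤ α k - τ k := by
    intro n hn
    induction n, hn using Nat.le_induction with
    | base => exact fun _ => le_rfl
    | succ n hn ih =>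
      intro hnk
      linarith [ih (by omega), hinc n (by omega) (by omega)]
  linarith [hend k₁ hk₁ le_rfl]

/-! ### The fair binomial distribution function -/

/-- The probability of `k` under `Bin(m, 1/2)`. -/
noncomputable def fairWeight (m k : ℕ) : ℝ := (m.choose k : ℝ) / 2 ^ m

/-- The probability of `{0, …, k - 1}` under `Bin(m, 1/2)`. -/
noncomputable def fairCDF (m k : ℕ) : ℝ := ∑ i ∈ Finset.range k, fairWeight m i

theorem fairWeight_nonneg (m k : ℕ) : 0 ≤ fairWeight m k := by
  unfold fairWeight
  positivity

theorem fairWeight_pos {m k : ℕ} (hk : k ≤ m) : 0 < fairWeight m k := by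
  have := Nat.choose_pos hk
  unfold fairWeight
  positivity

theorem fairCDF_zero (m : ℕ) : fairCDF m 0 = 0 := by simp [fairCDF]

theorem fairCDF_succ (m k : ℕ) : fairCDF m (k + 1) = fairCDF m k + fairWeight m k :=
  Finset.sum_range_succ _ _

theorem monotone_fairCDF (m : ℕ) : Monotone (fairCDF m) :=
  monotone_nat_of_le_succ fun k => by
    rw [fairCDF_succ]
    linarith [fairWeight_nonneg m k]

theorem fairCDF_nonneg (m k : ℕ) : 0 ≤ fairCDF m k :=
  Finset.sum_nonneg fun i _ => fairWeight_nonneg m i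

theorem fairCDF_last (m : ℕ) : fairCDF m (m + 1) = 1 := by
  have h := Nat.sum_range_choose m
  unfold fairCDF fairWeight
  rw [← Finset.sum_div, div_eq_one_iff_eq (by positivity)]
  exact_mod_cast h

theorem fairCDF_le_one {m k : ℕ} (hk : k ≤ m + 1) : fairCDF m k ≤ 1 :=
  (monotone_fairCDF m hk).trans_eq (fairCDF_last m)

theorem fairCDF_reflect (m k : ℕ) (hk : k ≤ m + 1) :
    fairCDF m (m + 1 - k) = 1 - fairCDF m k := by
  induction k with
  | zero => simp [fairCDF_last, fairCDF_zero]
  | succ k ih =>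
    have h1 := ih (by omega)
    have h2 : m + 1 - k = (m + 1 - (k + 1)) + 1 := by omega
    rw [h2, fairCDF_succ] at h1
    have h3 : fairWeight m (m + 1 - (k + 1)) = fairWeight m k := by
      unfold fairWeight
      rw [show m + 1 - (k + 1) = m - k by omega, Nat.choose_symm (by omega)]
    rw [fairCDF_succ]
    linarith

theorem fairWeight_succ_mul {m k : ℕ} (hk : k ≤ m) :
    fairWeight m (k + 1) * (k + 1) = fairWeight m k * (m - k) := by
  have h := Nat.choose_succ_right_eq m k
  have h' : (m.choose (k + 1) : ℝ) * (k + 1) = m.choose k * (m - k) := by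
    rw [← Nat.cast_sub hk]
    exact_mod_cast h
  unfold fairWeight
  rw [div_mul_eq_mul_div, h', mul_div_right_comm]

/-! ### Binomial tails against normal tails -/

theorem one_sub_mul_exp_le {u : ℝ} (h0 : 0 ≤ u) (h1 : u ≤ 1) :
    (1 - u) ≤ (1 + u) * Real.exp (-(2 * u)) := by
  rcases h1.eq_or_lt with rfl | h1
  · simp
    positivity
  have h := Real.sum_range_le_log_div h0 h1 1
  simp only [Finset.range_one, Finset.sum_singleton] at h
  have h2 : 2 * u ≤ Real.log ((1 + u) / (1 - u)) := by
    norm_num at h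
    linarith
  rw [Real.le_log_iff_exp_le (by apply div_pos <;> linarith), le_div_iff₀ (by linarith)] at h2
  rw [Real.exp_neg, ← div_eq_mul_inv, le_div_iff₀ (Real.exp_pos _)]
  linarith

theorem one_add_le_exp_mul {v : ℝ} (h0 : 0 ≤ v) (h1 : v ≤ 1 / 2) :
    (1 + v) ≤ (1 - v) * Real.exp (2 * v + 8 / 3 * v ^ 3) := by
  have h := Real.log_div_le_sum_range_add h0 (by linarith) 1
  simp only [Finset.range_one, Finset.sum_singleton] at h
  have h3 : v ^ 3 / (1 - v ^ 2) ≤ 4 / 3 * v ^ 3 := by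
    rw [div_le_iff₀ (by nlinarith)]
    have h3 : 0 ≤ v ^ 3 := by positivity
    have h4 : v ^ 2 ≤ 1 / 4 := by nlinarith
    nlinarith [mul_le_mul_of_nonneg_left h4 h3]
  have h2 : Real.log ((1 + v) / (1 - v)) ≤ 2 * v + 8 / 3 * v ^ 3 := by
    norm_num at h
    linarith
  rw [Real.log_le_iff_le_exp (by apply div_pos <;> linarith), div_le_iff₀ (by linarith)] at h2
  linarith

/-- With `u = (2k - m)/m`, the ratio `(m - k)/(k + 1)` of successive binomial weights is at most `(1
- u)/(1 + u) ≤ exp(-2u)`, and the corresponding ratio of normal increments is at least `exp(-2u)`.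
The comparison runs from just above the centre, where symmetry decides, to `k = m + 1`, where the
binomial tail vanishes. -/
theorem stdNormalCDF_le_fairCDF {m k : ℕ} (hk : m / 2 < k) (hkm : k ≤ m + 1) (hm : 0 < m) :
    stdNormalCDF ((2 * k - m - 3) / √m) ≤ fairCDF m k := by
  have hs : 0 < √(m : ℝ) := by positivity
  have hss : √(m : ℝ) ^ 2 = m := Real.sq_sqrt (by positivity)
  have hm' : (0 : ℝ) < m := by exact_mod_cast hm
  have key := le_of_increment_ratio_monotone
    (α := fun k => 1 - stdNormalCDF ((2 * k - m - 3) / √m)) (τ := fun k => 1 - fairCDF m k)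
    (k₀ := m / 2 + 1) (k₁ := m + 1) ?_ ?_ ?_ ?_ k hk hkm
  · linarith
  · have h1 : 1 / 2 ≤ fairCDF m (m / 2 + 1) := by
      have h := fairCDF_reflect m (m / 2 + 1) (by omega)
      have h' := monotone_fairCDF m (show m + 1 - (m / 2 + 1) ≤ m / 2 + 1 by omega)
      linarith
    have h2 : stdNormalCDF ((2 * (m / 2 + 1 : ℕ) - m - 3) / √m) ≤ 1 / 2 := by
      rw [← stdNormalCDF_zero]
      apply strictMono_stdNormalCDF.monotone
      apply div_nonpos_of_nonpos_of_nonneg _ hs.le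
      have : 2 * (m / 2 + 1) ≤ m + 2 := by omega
      have : 2 * ((m / 2 + 1 : ℕ) : ℝ) ≤ m + 2 := by exact_mod_cast this
      linarith
    linarith
  · simp only [fairCDF_last, sub_self]
    linarith [stdNormalCDF_lt_one ((2 * ((m + 1 : ℕ) : ℝ) - m - 3) / √m)]
  · intro k _ hk
    simp only [fairCDF_succ]
    linarith [fairWeight_pos (show k ≤ m by omega)]
  · intro k hk0 hk1
    have hkm : k + 1 ≤ m := by omega
    rw [show k + 2 = k + 1 + 1 from rfl, fairCDF_succ m (k + 1), fairCDF_succ m k]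
    have hinc := stdNormalCDF_increment_ge (a := (2 * k - m - 3) / √(m : ℝ)) (d := 2 / √(m : ℝ))
      (by positivity)
    have e1 : (2 * k - m - 3) / √(m : ℝ) + 2 / √(m : ℝ) =
        (2 * ((k + 1 : ℕ) : ℝ) - m - 3) / √m := by
      push_cast; ring
    have e2 : (2 * k - m - 3) / √(m : ℝ) + 2 * (2 / √(m : ℝ)) =
        (2 * ((k + 1 + 1 : ℕ) : ℝ) - m - 3) / √m := by
      push_cast; ring
    -- The shift by `3` is what makes the exponent exactly `-2u`: it compensates both the step to
    -- the right end of the interval and the quadratic term.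
    have e3 : -(((2 * k - m - 3) / √(m : ℝ) + 2 / √(m : ℝ)) * (2 / √(m : ℝ))) -
        (2 / √(m : ℝ)) ^ 2 / 2 = -(2 * ((2 * k - m) / m)) := by
      field_simp
      rw [hss]
      field_simp
      ring
    rw [e3, e1, e2] at hinc
    set A := stdNormalCDF ((2 * ((k + 1 : ℕ) : ℝ) - m - 3) / √m) -
      stdNormalCDF ((2 * (k : ℝ) - m - 3) / √m)
    set E := Real.exp (-(2 * ((2 * (k : ℝ) - m) / m)))
    have hA : 0 ≤ A := by
      refine sub_nonneg.2 (strictMono_stdNormalCDF.monotone ?_)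
      gcongr
      linarith
    have hw : fairWeight m (k + 1) ≤ fairWeight m k * E := by
      have hk2 : (m : ℝ) ≤ 2 * k := by
        have : m ≤ 2 * k := by omega
        exact_mod_cast this
      have hk3 : (k : ℝ) + 1 ≤ m := by exact_mod_cast hkm
      have hu := one_sub_mul_exp_le (u := (2 * (k : ℝ) - m) / m)
        (div_nonneg (by linarith) hm'.le) ((div_le_one hm').2 (by linarith))
      have hu' : (m : ℝ) - k ≤ k * E := by
        have e4 : 1 - (2 * (k : ℝ) - m) / m = 2 / m * (m - k) := by field_simp; ring
        have e5 : 1 + (2 * (k : ℝ) - m) / m = 2 / m * k := by field_simp; ring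
        rw [e4, e5, mul_assoc] at hu
        exact le_of_mul_le_mul_left hu (by positivity)
      have hE : 0 < E := Real.exp_pos _
      have h1 := fairWeight_succ_mul (show k ≤ m by omega)
      have h2 := fairWeight_nonneg m k
      refine le_of_mul_le_mul_right (a := (k : ℝ) + 1) ?_ (by positivity)
      rw [h1]
      nlinarith [mul_le_mul_of_nonneg_left hu' h2, mul_nonneg h2 hE.le]
    have hw0 := fairWeight_nonneg m k
    have h1 : fairWeight m (k + 1) * A ≤ fairWeight m k * (E * A) := by
      rw [← mul_assoc]
      gcongr
    have h2 := mul_le_mul_of_nonneg_left hinc hw0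
    calc _ = fairWeight m (k + 1) * A := by ring
      _ ≤ _ := h1
      _ ≤ _ := h2
      _ = _ := by ring

/-- The points at which the tail of the normal law is dominated by the tail of `Bin(m, 1/2)`,
with `x = 2k - m`. -/
noncomputable def tailPoint (m : ℕ) (x : ℝ) : ℝ :=
  (2000 + x + 128 * x ^ 3 / m ^ 2) / √m

theorem tailPoint_nonneg {m : ℕ} {x : ℝ} (hx : 0 ≤ x) : 0 ≤ tailPoint m x := by
  unfold tailPoint
  positivity

/-- With `v = (x + 1)/m`, the bound needed is `(1 - v)/(1 + v) ≥ exp(-2v - 8v³/3)`. The unequal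
interval lengths cost a factor at most `exp(1536(x + 2)/m²)`. In the difference of squares, the
constant `2000` of `tailPoint` pays for that factor and for lower-order terms, and its cubic term
pays for `8v³/3`. -/
theorem tailPoint_ratio_le {m : ℕ} {x : ℝ} (hm : 64 ≤ m) (hx : 0 ≤ x) (hx1 : 2 * (x + 1) ≤ m) :
    tailPoint m x < tailPoint m (x + 2) ∧
    tailPoint m (x + 2) - tailPoint m x ≤ tailPoint m (x + 4) - tailPoint m (x + 2) ∧
    (tailPoint m (x + 4) - tailPoint m (x + 2)) / (tailPoint m (x + 2) - tailPoint m x) *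
        Real.exp (-((tailPoint m (x + 2) ^ 2 - tailPoint m x ^ 2) / 2)) * (1 + (x + 1) / m) ≤
      1 - (x + 1) / m := by
  have hmr : (64 : ℝ) ≤ m := by exact_mod_cast hm
  have hm' : (0 : ℝ) < m := by linarith
  have hs : 0 < √(m : ℝ) := by positivity
  have hss : √(m : ℝ) ^ 2 = m := Real.sq_sqrt (by positivity)
  have ed : tailPoint m (x + 2) - tailPoint m x =
      (2 + 128 * (6 * x ^ 2 + 12 * x + 8) / m ^ 2) / √m := by
    unfold tailPoint; ring
  have ed' : tailPoint m (x + 4) - tailPoint m (x + 2) =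
      (2 + 128 * (6 * (x + 2) ^ 2 + 12 * (x + 2) + 8) / m ^ 2) / √m := by
    unfold tailPoint; ring
  set q := 128 * (6 * x ^ 2 + 12 * x + 8) / (m : ℝ) ^ 2 with hq
  set q' := 128 * (6 * (x + 2) ^ 2 + 12 * (x + 2) + 8) / (m : ℝ) ^ 2 with hq'
  have hq0 : 0 ≤ q := by positivity
  have hqq : q' = q + 3072 * (x + 2) / m ^ 2 := by rw [hq, hq']; ring
  have hqq0 : 0 ≤ 3072 * (x + 2) / (m : ℝ) ^ 2 := by positivity
  refine ⟨?_, ?_, ?_⟩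
  · rw [← sub_pos, ed]
    positivity
  · rw [ed, ed', hqq]
    gcongr
    linarith
  have hratio : (tailPoint m (x + 4) - tailPoint m (x + 2)) /
      (tailPoint m (x + 2) - tailPoint m x) ≤ Real.exp (1536 * (x + 2) / m ^ 2) := by
    rw [ed, ed', div_div_div_cancel_right₀ hs.ne']
    refine le_trans ?_ (Real.add_one_le_exp _)
    rw [div_le_iff₀ (by positivity), hqq]
    have : 3072 * (x + 2) / (m : ℝ) ^ 2 = 2 * (1536 * (x + 2) / (m : ℝ) ^ 2) := by ring
    rw [this]
    have : 0 ≤ 1536 * (x + 2) / (m : ℝ) ^ 2 := by positivity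
    nlinarith
  have hsq : (4002 + 2 * x + 256 * x ^ 3 / m ^ 2) / m ≤
      (tailPoint m (x + 2) ^ 2 - tailPoint m x ^ 2) / 2 := by
    have e : (tailPoint m (x + 2) ^ 2 - tailPoint m x ^ 2) / 2 =
        ((2 + q) / √m) * (tailPoint m (x + 2) + tailPoint m x) / 2 := by
      rw [← ed]; ring
    have e2 : tailPoint m (x + 2) + tailPoint m x =
        (4002 + 2 * x + 256 * x ^ 3 / m ^ 2 + 128 * (6 * x ^ 2 + 12 * x + 8) / m ^ 2) / √m := by
      unfold tailPoint; ring
    rw [e, e2, ← hq]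
    have e3 : ∀ c : ℝ, ((2 + q) / √m) * (c / √m) / 2 = (2 + q) * c / 2 / m := by
      intro c
      rw [div_mul_div_comm, ← sq, hss]
      ring
    rw [e3]
    gcongr
    have : 0 ≤ 256 * x ^ 3 / (m : ℝ) ^ 2 := by positivity
    nlinarith
  have hv := one_add_le_exp_mul (v := (x + 1) / m) (by positivity)
    ((div_le_iff₀ hm').2 (by linarith))
  have hv1 : 0 ≤ 1 - (x + 1) / m := by
    rw [sub_nonneg, div_le_one hm']; linarith
  have hmain : 1536 * (x + 2) / (m : ℝ) ^ 2 +
      -((tailPoint m (x + 2) ^ 2 - tailPoint m x ^ 2) / 2) +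
      (2 * ((x + 1) / m) + 8 / 3 * ((x + 1) / m) ^ 3) ≤ 0 := by
    have h : 1536 * (x + 2) / (m : ℝ) ^ 2 +
        (2 * ((x + 1) / m) + 8 / 3 * ((x + 1) / m) ^ 3) ≤
        (4002 + 2 * x + 256 * x ^ 3 / m ^ 2) / m := by
      have e1 : 1536 * (x + 2) / (m : ℝ) ^ 2 +
        (2 * ((x + 1) / m) + 8 / 3 * ((x + 1) / m) ^ 3) =
        (1536 * (x + 2) * m + 2 * (x + 1) * m ^ 2 + 8 / 3 * (x + 1) ^ 3) / m ^ 3 := by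
        field_simp
        ring
      have e2 : (4002 + 2 * x + 256 * x ^ 3 / m ^ 2) / m =
        (4002 * m ^ 2 + 2 * x * m ^ 2 + 256 * x ^ 3) / (m : ℝ) ^ 3 := by
        field_simp
      rw [e1, e2]
      gcongr ?_ / _
      have c1 : (x + 1) ^ 3 ≤ 4 * (x ^ 3 + 1) := by
        nlinarith [mul_nonneg (add_nonneg hx zero_le_one) (sq_nonneg (x - 1))]
      have c2 : 1536 * (x + 2) * m ≤ 1536 * (m / 2 + 1) * m := by
        refine mul_le_mul_of_nonneg_right ?_ hm'.le
        linarith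
      have c3 : 0 ≤ x ^ 3 := by positivity
      nlinarith
    linarith
  calc _ ≤ Real.exp (1536 * (x + 2) / m ^ 2) *
        Real.exp (-((tailPoint m (x + 2) ^ 2 - tailPoint m x ^ 2) / 2)) *
        ((1 - (x + 1) / m) * Real.exp (2 * ((x + 1) / m) + 8 / 3 * ((x + 1) / m) ^ 3)) := by
        gcongr
    _ = (1 - (x + 1) / m) * Real.exp (1536 * (x + 2) / (m : ℝ) ^ 2 +
      -((tailPoint m (x + 2) ^ 2 - tailPoint m x ^ 2) / 2) +
      (2 * ((x + 1) / m) + 8 / 3 * ((x + 1) / m) ^ 3)) := by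
        rw [Real.exp_add (_ + _), Real.exp_add (1536 * (x + 2) / (m : ℝ) ^ 2)]; ring
    _ ≤ (1 - (x + 1) / m) * 1 := by
        gcongr
        exact Real.exp_le_one_iff.2 hmain
    _ = _ := mul_one _

/-- The comparison in the opposite direction. It stops at `3m/4`, since the cubic bound on `log((1 +
v)/(1 - v))` is used only for `v ≤ 1/2`. -/
theorem fairCDF_le_stdNormalCDF {m k : ℕ} (hm : 64 ≤ m) (hk : (m + 1) / 2 ≤ k)
    (hkm : k ≤ 3 * m / 4) : fairCDF m k ≤ stdNormalCDF (tailPoint m (2 * k - m)) := by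
  have hmr : (64 : ℝ) ≤ m := by exact_mod_cast hm
  have hm' : (0 : ℝ) < m := by linarith
  have hs : 0 < √(m : ℝ) := by positivity
  have hss : √(m : ℝ) ^ 2 = m := Real.sq_sqrt (by positivity)
  have hx : ∀ k : ℕ, (m + 1) / 2 ≤ k → (0 : ℝ) ≤ 2 * k - m := by
    intro k hk
    have : m ≤ 2 * k := by omega
    have : (m : ℝ) ≤ 2 * k := by exact_mod_cast this
    linarith
  have ec : ∀ k : ℕ, (2 * ((k + 1 : ℕ) : ℝ) - m) = 2 * k - m + 2 := by
    intro k; push_cast; ring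
  have ec2 : ∀ k : ℕ, (2 * ((k + 1 + 1 : ℕ) : ℝ) - m) = 2 * k - m + 4 := by
    intro k; push_cast; ring
  have hx1 : ∀ k : ℕ, k + 1 ≤ 3 * m / 4 → 2 * ((2 * k - m : ℝ) + 1) ≤ m := by
    intro k hk
    have : 4 * k + 2 ≤ 3 * m := by omega
    have : (4 * k + 2 : ℝ) ≤ 3 * m := by exact_mod_cast this
    linarith
  have key := le_of_increment_ratio_monotone
    (τ := fun k => 1 - stdNormalCDF (tailPoint m (2 * k - m))) (α := fun k => 1 - fairCDF m k)
    (k₀ := (m + 1) / 2) (k₁ := 3 * m / 4) ?_ ?_ ?_ ?_ k hk hkm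
  · linarith
  · have h1 : fairCDF m ((m + 1) / 2) ≤ 1 / 2 := by
      have h := fairCDF_reflect m ((m + 1) / 2) (by omega)
      have h' := monotone_fairCDF m (show (m + 1) / 2 ≤ m + 1 - (m + 1) / 2 by omega)
      linarith
    have h2 : 1 / 2 ≤ stdNormalCDF (tailPoint m (2 * ((m + 1) / 2 : ℕ) - m)) := by
      rw [← stdNormalCDF_zero]
      exact strictMono_stdNormalCDF.monotone (tailPoint_nonneg (hx _ le_rfl))
    linarith
  -- At the right end `x ≥ m/4`, so the coefficient `128` pushes `tailPoint` beyond `2√m`. There the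
  -- normal tail is below `2^{-m}`, the single atom at `m`.
  · have hk1 : (m : ℝ) / 4 ≤ 2 * (3 * m / 4 : ℕ) - m := by
      have : 3 * m ≤ 4 * (3 * m / 4) + 3 := by omega
      have : (3 * m : ℝ) ≤ 4 * (3 * m / 4 : ℕ) + 3 := by exact_mod_cast this
      linarith
    have hb : 2 * √(m : ℝ) ≤ tailPoint m (2 * (3 * m / 4 : ℕ) - m) := by
      unfold tailPoint
      rw [le_div_iff₀ hs, mul_assoc, ← sq, hss]
      have : 2 * (m : ℝ) ≤ 128 * (2 * (3 * m / 4 : ℕ) - m : ℝ) ^ 3 / m ^ 2 := by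
        rw [le_div_iff₀ (by positivity)]
        calc 2 * (m : ℝ) * m ^ 2 = 128 * (m / 4) ^ 3 := by ring
          _ ≤ _ := by gcongr
      linarith
    have h1 := one_sub_stdNormalCDF_le_exp (x := tailPoint m (2 * (3 * m / 4 : ℕ) - m))
      (le_trans (by positivity) hb)
    have h2 : Real.exp (-tailPoint m (2 * (3 * m / 4 : ℕ) - m) ^ 2 / 2) ≤ fairWeight m m := by
      have h3 : (2 * √(m : ℝ)) ^ 2 ≤ tailPoint m (2 * (3 * m / 4 : ℕ) - m) ^ 2 := by gcongr
      rw [mul_pow, hss] at h3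
      have h4 : Real.exp (-tailPoint m (2 * (3 * m / 4 : ℕ) - m) ^ 2 / 2) ≤
          Real.exp (-(m : ℝ)) := by
        apply Real.exp_le_exp.2
        linarith
      refine h4.trans ?_
      rw [fairWeight, Nat.choose_self, Nat.cast_one, Real.exp_neg, ← one_div]
      gcongr
      rw [← Real.exp_one_pow]
      gcongr
      linarith [Real.add_one_le_exp (1 : ℝ)]
    have h3 : fairCDF m (3 * m / 4) ≤ fairCDF m m := monotone_fairCDF m (by omega)
    have h4 := fairCDF_succ m m
    rw [fairCDF_last] at h4
    linarith
  · intro k hk0 hk1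
    obtain ⟨h, -, -⟩ := tailPoint_ratio_le hm (hx k hk0) (hx1 k (by omega))
    have := strictMono_stdNormalCDF h
    rw [ec]
    linarith
  · intro k hk0 hk1
    have hk2 : k ≤ m := by omega
    obtain ⟨h1, h2, h3⟩ := tailPoint_ratio_le hm (hx k hk0) (hx1 k (by omega))
    have h4 := stdNormalCDF_increment_le (tailPoint_nonneg (hx k hk0)) h1 h2
    rw [show k + 2 = k + 1 + 1 from rfl, fairCDF_succ m (k + 1), fairCDF_succ m k, ec, ec2]
    set x : ℝ := 2 * k - m with hxdef
    set ρ := (tailPoint m (x + 4) - tailPoint m (x + 2)) / (tailPoint m (x + 2) - tailPoint m x) *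
        Real.exp (-((tailPoint m (x + 2) ^ 2 - tailPoint m x ^ 2) / 2))
    have hA : 0 ≤ stdNormalCDF (tailPoint m (x + 2)) - stdNormalCDF (tailPoint m x) :=
      (sub_pos.2 (strictMono_stdNormalCDF h1)).le
    have hρ0 : 0 ≤ ρ :=
      mul_nonneg (div_nonneg (by linarith) (by linarith)) (Real.exp_pos _).le
    have hρ : ρ * (k + 1) ≤ m - k := by
      have hxk := hx k hk0
      have e1 : ρ * (1 + (x + 1) / m) = 2 / m * (ρ * (k + 1 / 2)) := by
        rw [hxdef]; field_simp; ring
      have e2 : 1 - (x + 1) / m = 2 / m * (m - k - 1 / 2) := by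
        rw [hxdef]; field_simp; ring
      rw [e1, e2] at h3
      have h5 := le_of_mul_le_mul_left h3 (by positivity)
      have hk1' : (k : ℝ) ≤ m := by exact_mod_cast hk2
      -- The ratio lemma gives `ρ(k + 1/2) ≤ m - k - 1/2`; adding `ρ/2 ≤ 1/2` turns this into the
      -- exact binomial ratio.
      have hρ1 : ρ ≤ 1 := by
        by_contra! hlt
        have : (k : ℝ) + 1 / 2 < ρ * (k + 1 / 2) := by
          nlinarith [(Nat.cast_nonneg k : (0 : ℝ) ≤ k)]
        linarith
      linarith
    have hw : ρ * fairWeight m k ≤ fairWeight m (k + 1) := by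
      refine le_of_mul_le_mul_right (a := (k : ℝ) + 1) ?_ (by positivity)
      rw [fairWeight_succ_mul hk2]
      nlinarith [mul_le_mul_of_nonneg_left hρ (fairWeight_nonneg m k)]
    have h6 := mul_le_mul_of_nonneg_right h4 (fairWeight_nonneg m k)
    have h7 := mul_le_mul_of_nonneg_right hw hA
    calc _ = (stdNormalCDF (tailPoint m (x + 4)) - stdNormalCDF (tailPoint m (x + 2))) *
          fairWeight m k := by ring
      _ ≤ _ := h6
      _ = _ := by ring
      _ ≤ _ := h7
      _ = _ := by ring

/-! ### Location of the bands -/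

theorem le_add_of_mem_band {m k : ℕ} {z : ℝ} (hm : 100000 ≤ m) (hk : (m + 1) / 2 ≤ k)
    (hkm : k + 1 ≤ 3 * m / 4) (h : stdNormalCDF z ≤ fairCDF m (k + 1)) :
    z ≤ (2 * k - m) / √m + (2002 + 128 * (2 * k - m + 2) ^ 3 / m ^ 2) / √m := by
  have h1 := h.trans (fairCDF_le_stdNormalCDF (by omega) (by omega) hkm)
  rw [strictMono_stdNormalCDF.le_iff_le] at h1
  refine h1.trans_eq ?_
  unfold tailPoint
  push_cast
  ring

theorem sub_le_of_mem_band {m k : ℕ} {z : ℝ} (hm : 100000 ≤ m) (hk : (m + 1) / 2 ≤ k)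
    (hkm : k ≤ m) (h : fairCDF m k ≤ stdNormalCDF z) :
    (2 * k - m) / √m - 3000 / √m ≤ z := by
  have hmr : (100000 : ℝ) ≤ m := by exact_mod_cast hm
  have hs : 0 < √(m : ℝ) := Real.sqrt_pos.2 (by linarith)
  rcases Nat.lt_or_ge (m / 2) k with hk' | hk'
  · have h1 := (stdNormalCDF_le_fairCDF hk' (by omega) (by omega)).trans h
    rw [strictMono_stdNormalCDF.le_iff_le] at h1
    refine le_trans ?_ h1
    rw [← sub_div]
    gcongr
    linarith
  -- For the central band of even `m` the lower bound comes from reflecting `z` and using the upper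
  -- bound at `x = 0`.
  · have hmk : m = 2 * k := by omega
    have h1 : stdNormalCDF (-z) ≤ fairCDF m (k + 1) := by
      rw [stdNormalCDF_neg, show k + 1 = m + 1 - k by omega, fairCDF_reflect m k (by omega)]
      linarith
    have h2 := le_add_of_mem_band hm hk (by omega) h1
    have e : (2 * k - m : ℝ) = 0 := by rw [hmk]; push_cast; ring
    rw [e] at h2 ⊢
    have h3 : (2002 + 128 * (0 + 2 : ℝ) ^ 3 / m ^ 2) / √m ≤ 3000 / √m := by
      gcongr
      have : 128 * (0 + 2 : ℝ) ^ 3 / m ^ 2 ≤ 1 := by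
        rw [div_le_one (by positivity)]
        nlinarith
      linarith
    have h4 : (0 : ℝ) / √m = 0 := zero_div _
    linarith

/-- If `√m ≤ 16|z|` or `m` is bounded, the crude bound `√m + |z|` is already of the right order.
Otherwise the lower bound on `z` keeps `k` below `3m/4`, so the upper bound applies too. The
constant `10 ^ 14` dominates `512 * 3002 ^ 3`, left over from cubing `√m|z| + 3002`. -/
theorem abs_sub_le_of_mem_upper_band {m k : ℕ} {z : ℝ} (hm : 0 < m) (hk : (m + 1) / 2 ≤ k)
    (hkm : k ≤ m) (h0 : fairCDF m k ≤ stdNormalCDF z) (h1 : stdNormalCDF z ≤ fairCDF m (k + 1)) :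
    |(2 * k - m) / √m - z| ≤ 10 ^ 14 * (1 / √m + |z| ^ 3 / m) := by
  have hm' : (0 : ℝ) < m := by exact_mod_cast hm
  have hs : 0 < √(m : ℝ) := Real.sqrt_pos.2 hm'
  have hss : √(m : ℝ) ^ 2 = m := Real.sq_sqrt (by positivity)
  have hp1 : 0 < 1 / √(m : ℝ) := by positivity
  have hp2 : 0 ≤ |z| ^ 3 / m := by positivity
  have hw0 : (0 : ℝ) ≤ (2 * k - m) / √m := by
    have : m ≤ 2 * k := by omega
    have : (m : ℝ) ≤ 2 * k := by exact_mod_cast this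
    apply div_nonneg _ hs.le
    linarith
  have hw1 : (2 * k - m) / √m ≤ √m := by
    have : (k : ℝ) ≤ m := by exact_mod_cast hkm
    rw [div_le_iff₀ hs, ← sq, hss]
    linarith
  have hz := abs_nonneg z
  have habs : |(2 * k - m) / √m - z| ≤ √m + |z| := by
    refine (abs_sub _ _).trans ?_
    rw [abs_of_nonneg hw0]
    linarith
  rcases le_or_gt (√m) (16 * |z|) with hbig | hsmall
  · have h2 : |z| ≤ 256 * (|z| ^ 3 / m) := by
      have : (m : ℝ) ≤ 256 * |z| ^ 2 := by
        rw [← hss]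
        nlinarith
      rw [← mul_div_assoc, le_div_iff₀ hm']
      nlinarith [mul_le_mul_of_nonneg_left this hz]
    linarith
  rcases Nat.lt_or_ge m 100000 with hlt | hm
  · have h2 : √(m : ℝ) ≤ 100000 * (1 / √m) := by
      have : (m : ℝ) ≤ 100000 := by exact_mod_cast hlt.le
      rw [← mul_div_assoc, le_div_iff₀ hs, ← sq, hss]
      linarith
    linarith
  have hmr : (100000 : ℝ) ≤ m := by exact_mod_cast hm
  have hlow := sub_le_of_mem_band hm hk hkm h0
  have hx1 : (2 * k - m : ℝ) ≤ √m * |z| + 3000 := by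
    have : (2 * k - m) / √m ≤ |z| + 3000 / √m := by linarith [le_abs_self z]
    rw [div_le_iff₀ hs, add_mul, div_mul_cancel₀ _ hs.ne'] at this
    linarith
  have hkm' : k + 1 ≤ 3 * m / 4 := by
    have h3 : √m * |z| ≤ m / 16 := by nlinarith
    have h4 : (4 * k + 4 : ℝ) ≤ 3 * m := by linarith
    have : 4 * k + 4 ≤ 3 * m := by exact_mod_cast h4
    omega
  have hup := le_add_of_mem_band hm hk hkm' h1
  have hx0 : (0 : ℝ) ≤ 2 * k - m + 2 := by
    have : m ≤ 2 * k := by omega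
    have : (m : ℝ) ≤ 2 * k := by exact_mod_cast this
    linarith
  have hcube : (2 * k - m + 2 : ℝ) ^ 3 ≤ 4 * (√m ^ 3 * |z| ^ 3 + 3002 ^ 3) := by
    have h2 : (2 * k - m + 2 : ℝ) ^ 3 ≤ (√m * |z| + 3002) ^ 3 :=
      pow_le_pow_left₀ hx0 (by linarith) 3
    have h3 : 0 ≤ √m * |z| := by positivity
    rw [← mul_pow]
    nlinarith [mul_nonneg (add_nonneg h3 (by norm_num : (0 : ℝ) ≤ 3002))
      (sq_nonneg (√m * |z| - 3002))]
  have herr : (2002 + 128 * (2 * k - m + 2 : ℝ) ^ 3 / m ^ 2) / √m ≤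
      (2002 + 512 * 3002 ^ 3) * (1 / √m) + 512 * (|z| ^ 3 / m) := by
    have h2 : 128 * (2 * k - m + 2 : ℝ) ^ 3 / m ^ 2 ≤
        512 * (√m ^ 3 * |z| ^ 3) / m ^ 2 + 512 * 3002 ^ 3 := by
      have h3 : 128 * (2 * k - m + 2 : ℝ) ^ 3 / m ^ 2 ≤
        128 * (4 * (√m ^ 3 * |z| ^ 3 + 3002 ^ 3)) / m ^ 2 := by gcongr
      have h4 : (512 * 3002 ^ 3 : ℝ) / m ^ 2 ≤ 512 * 3002 ^ 3 :=
        div_le_self (by norm_num) (by nlinarith)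
      refine h3.trans ?_
      rw [mul_add, mul_add, add_div]
      have e : (128 * (4 * 3002 ^ 3) : ℝ) / m ^ 2 = 512 * 3002 ^ 3 / m ^ 2 := by ring
      have e' : (128 * (4 * (√m ^ 3 * |z| ^ 3)) : ℝ) / m ^ 2 =
        512 * (√m ^ 3 * |z| ^ 3) / m ^ 2 := by ring
      rw [e, e']
      linarith
    have h5 : 512 * (√m ^ 3 * |z| ^ 3) / (m : ℝ) ^ 2 / √m = 512 * (|z| ^ 3 / m) := by
      have : (m : ℝ) ^ 2 = m * √m ^ 2 := by rw [hss]; ring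
      rw [this]
      field_simp
    calc _ ≤ (2002 + (512 * (√m ^ 3 * |z| ^ 3) / m ^ 2 + 512 * 3002 ^ 3)) / √m := by gcongr
      _ = (2002 + 512 * 3002 ^ 3) * (1 / √m) + 512 * (√m ^ 3 * |z| ^ 3) / m ^ 2 / √m := by ring
      _ = _ := by rw [h5]
  have hlow' : (2 * k - m) / √m - z ≤ 3000 * (1 / √m) := by
    rw [mul_one_div]; linarith
  rw [abs_le]
  constructor
  · have h6 : (2002 + 512 * 3002 ^ 3) * (1 / √(m : ℝ)) ≤ 10 ^ 14 * (1 / √m) :=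
      mul_le_mul_of_nonneg_right (by norm_num) hp1.le
    linarith
  · linarith

/-- The quantile coupling of `Bin(m, 1/2)` and the normal law: if `z` lies in the band of
`k`, then the standardized value of `k` is close to `z`. -/
theorem abs_sub_le_of_mem_band {m k : ℕ} {z : ℝ} (hm : 0 < m) (hkm : k ≤ m)
    (h0 : fairCDF m k ≤ stdNormalCDF z) (h1 : stdNormalCDF z ≤ fairCDF m (k + 1)) :
    |(2 * k - m) / √m - z| ≤ 10 ^ 14 * (1 / √m + |z| ^ 3 / m) := by
  rcases Nat.lt_or_ge k ((m + 1) / 2) with hk | hk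
  · have h2 : fairCDF m (m - k) ≤ stdNormalCDF (-z) := by
      rw [stdNormalCDF_neg, show m - k = m + 1 - (k + 1) by omega,
        fairCDF_reflect m (k + 1) (by omega)]
      linarith
    have h3 : stdNormalCDF (-z) ≤ fairCDF m (m - k + 1) := by
      rw [stdNormalCDF_neg, show m - k + 1 = m + 1 - k by omega,
        fairCDF_reflect m k (by omega)]
      linarith
    have h4 := abs_sub_le_of_mem_upper_band hm (by omega) (by omega) h2 h3
    rw [abs_neg, Nat.cast_sub hkm] at h4
    convert h4 using 1
    rw [← abs_neg]
    congr 1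
    ring
  · exact abs_sub_le_of_mem_upper_band hm hk hkm h0 h1

/-! ### The density of the transformed variable -/

/-- The ratio of the probabilities of `k` under `Bin(m, p)` and `Bin(m, 1/2)`. -/
noncomputable def binomialRatio (m : ℕ) (p : unitInterval) (k : ℕ) : ℝ :=
  (2 * (p : ℝ)) ^ k * (2 * (1 - (p : ℝ))) ^ (m - k)

theorem binomialRatio_nonneg (m : ℕ) (p : unitInterval) (k : ℕ) : 0 ≤ binomialRatio m p k := by
  have := p.2.1
  have : 0 ≤ 1 - (p : ℝ) := sub_nonneg.2 p.2.2
  unfold binomialRatio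
  positivity

theorem binomialRatio_mul_fairWeight {m k : ℕ} (hk : k ≤ m) (p : unitInterval) :
    binomialRatio m p k * fairWeight m k =
      (m.choose k) * (p : ℝ) ^ k * (1 - (p : ℝ)) ^ (m - k) := by
  unfold binomialRatio fairWeight
  have : (2 : ℝ) ^ m = 2 ^ k * 2 ^ (m - k) := by rw [← pow_add]; congr 1; omega
  rw [mul_pow, mul_pow, this]
  field_simp

theorem binomialRatio_oneHalf (m k : ℕ) : binomialRatio m oneHalf k = 1 := by
  unfold binomialRatio oneHalf
  norm_num

/-- The density of `Φ⁻¹(F_m(X + U))`, up to a null set. -/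
noncomputable def bandDensity (m : ℕ) (p : unitInterval) (z : ℝ) : ℝ :=
  stdNormalPDF z * ∑ k ∈ Finset.range (m + 1),
    (Set.Ioo (fairCDF m k) (fairCDF m (k + 1))).indicator (fun _ => binomialRatio m p k)
      (stdNormalCDF z)

theorem binomial_prod_apply (m : ℕ) (p : unitInterval) (ν : Measure ℝ) [SFinite ν]
    {A : Set (ℕ × ℝ)} (hA : MeasurableSet A) :
    ((binomial m p).prod ν) A = ∑ k ∈ Finset.range (m + 1),
      ENNReal.ofReal (binomialRatio m p k * fairWeight m k) * ν (Prod.mk k ⁻¹' A) := by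
  rw [Measure.prod_apply hA, binomial_eq_sum_dirac, lintegral_finsetSum_measure]
  have : Finset.Iic m = Finset.range (m + 1) := by
    ext; simp
  rw [this]
  refine Finset.sum_congr rfl fun k hk => ?_
  rw [binomialRatio_mul_fairWeight (by simpa [Nat.lt_succ_iff] using hk), lintegral_smul_measure,
    lintegral_dirac, smul_eq_mul]

theorem measurable_nat_add : Measurable (fun q : ℕ × ℝ => (q.1 : ℝ) + q.2) :=
  ((measurable_of_countable (fun n : ℕ => (n : ℝ))).comp measurable_fst).add measurable_snd

theorem measurable_quantileCoupling (m : ℕ) : Measurable (quantileCoupling m) :=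
  measurable_stdNormalQuantile.comp
    ((monotone_cdf (smoothedBinomial m oneHalf)).measurable.comp measurable_nat_add)

theorem uniformNoise_preimage_Iic {j k : ℕ} {u : ℝ} (hu : u ∈ Set.Ico (-(1 / 2) : ℝ) (1 / 2)) :
    uniformNoise {v : ℝ | (j : ℝ) + v ≤ k + u} =
      if j < k then 1 else if j = k then ENNReal.ofReal (u + 1 / 2) else 0 := by
  have hmeas : MeasurableSet {v : ℝ | (j : ℝ) + v ≤ k + u} :=
    measurableSet_le (by fun_prop) (by fun_prop)
  rw [uniformNoise, Measure.restrict_apply hmeas]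
  obtain ⟨hu0, hu1⟩ := hu
  split_ifs with h1 h2
  · have h : (j : ℝ) + 1 ≤ k := by exact_mod_cast h1
    rw [Set.inter_eq_right.2, Real.volume_Ico]
    · norm_num
    · rintro v ⟨hv0, hv1⟩
      simp only [Set.mem_ofPred_eq]
      linarith
  · subst h2
    have : {v : ℝ | (j : ℝ) + v ≤ j + u} ∩ Set.Ico (-(1 / 2) : ℝ) (1 / 2) =
        Set.Icc (-(1 / 2)) u := by
      ext v
      simp only [Set.mem_inter_iff, Set.mem_ofPred_eq, Set.mem_Ico, Set.mem_Icc]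
      constructor
      · rintro ⟨h, h0, -⟩
        exact ⟨h0, by linarith⟩
      · rintro ⟨h0, h⟩
        exact ⟨by linarith, h0, by linarith⟩
    rw [this, Real.volume_Icc]
    congr 1
    ring
  · have h : (k : ℝ) + 1 ≤ j := by
      have : k + 1 ≤ j := by omega
      exact_mod_cast this
    convert measure_empty (μ := (volume : Measure ℝ))
    rw [Set.eq_empty_iff_forall_notMem]
    rintro v ⟨hv, hv0, hv1⟩
    simp only [Set.mem_ofPred_eq] at hv
    linarith

theorem binomialSmoothCDF_add {m k : ℕ} (hk : k ≤ m) {u : ℝ}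
    (hu : u ∈ Set.Ico (-(1 / 2) : ℝ) (1 / 2)) :
    binomialSmoothCDF m (k + u) = fairCDF m k + fairWeight m k * (u + 1 / 2) := by
  have hu0 : 0 ≤ u + 1 / 2 := by linarith [hu.1]
  have h1 : (smoothedBinomial m oneHalf) (Set.Iic (k + u)) =
      ENNReal.ofReal (fairCDF m k + fairWeight m k * (u + 1 / 2)) := by
    rw [smoothedBinomial, Measure.map_apply measurable_nat_add measurableSet_Iic,
      binomial_prod_apply _ _ _ (measurable_nat_add measurableSet_Iic)]
    have h2 : ∀ j, Prod.mk j ⁻¹' ((fun q : ℕ × ℝ => (q.1 : ℝ) + q.2) ⁻¹' Set.Iic (k + u)) =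
        {v : ℝ | (j : ℝ) + v ≤ k + u} := fun j => rfl
    have hsub : Finset.range (k + 1) ⊆ Finset.range (m + 1) :=
      Finset.range_mono (by omega)
    rw [← Finset.sum_subset hsub]
    · rw [Finset.sum_range_succ, fairCDF,
        ENNReal.ofReal_add (Finset.sum_nonneg fun i _ => fairWeight_nonneg m i)
          (mul_nonneg (fairWeight_nonneg m k) hu0),
        ENNReal.ofReal_sum_of_nonneg fun i _ => fairWeight_nonneg m i]
      congr 1
      · refine Finset.sum_congr rfl fun j hj => ?_
        rw [h2, uniformNoise_preimage_Iic hu, if_pos (Finset.mem_range.1 hj),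
          binomialRatio_oneHalf, one_mul, mul_one]
      · rw [h2, uniformNoise_preimage_Iic hu, if_neg (lt_irrefl k), if_pos rfl,
          binomialRatio_oneHalf, one_mul, ENNReal.ofReal_mul (fairWeight_nonneg m k)]
    · intro j _ hj
      have hj' : k < j := by simpa [Nat.lt_succ_iff] using hj
      rw [h2, uniformNoise_preimage_Iic hu, if_neg (by omega), if_neg (by omega), mul_zero]
  rw [binomialSmoothCDF, cdf_eq_real, measureReal_def, h1, ENNReal.toReal_ofReal]
  exact add_nonneg (fairCDF_nonneg m k) (mul_nonneg (fairWeight_nonneg m k) hu0)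

/-- An affine change of variables: `F_m` carries the unit interval around `k` linearly onto the
`k`-th interval of values, with slope `fairWeight m k`. -/
theorem fairWeight_mul_uniformNoise {m k : ℕ} (hk : k ≤ m) {A : Set ℝ} (hA : MeasurableSet A) :
    ENNReal.ofReal (fairWeight m k) *
        uniformNoise {u | fairCDF m k + fairWeight m k * (u + 1 / 2) ∈ A} =
      volume (Set.Ioo (fairCDF m k) (fairCDF m (k + 1)) ∩ A) := by
  have hw := fairWeight_pos hk
  have hset : {u | fairCDF m k + fairWeight m k * (u + 1 / 2) ∈ A} ∩
        Set.Ico (-(1 / 2) : ℝ) (1 / 2) =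
      (fun u => fairWeight m k * u) ⁻¹' ((fun x => (fairCDF m k + fairWeight m k / 2) + x) ⁻¹'
        (A ∩ Set.Ico (fairCDF m k) (fairCDF m (k + 1)))) := by
    ext u
    simp only [Set.mem_inter_iff, Set.mem_ofPred_eq, Set.mem_Ico, Set.mem_preimage, fairCDF_succ]
    have e : fairCDF m k + fairWeight m k / 2 + fairWeight m k * u =
      fairCDF m k + fairWeight m k * (u + 1 / 2) := by ring
    rw [e]
    refine and_congr_right fun _ => and_congr ?_ ?_
    · rw [le_add_iff_nonneg_right, mul_nonneg_iff_of_pos_left hw]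
      constructor <;> intro <;> linarith
    · rw [add_lt_add_iff_left, mul_lt_iff_lt_one_right hw]
      constructor <;> intro <;> linarith
  have hmeas : MeasurableSet {u | fairCDF m k + fairWeight m k * (u + 1 / 2) ∈ A} :=
    hA.preimage (by fun_prop)
  rw [uniformNoise, Measure.restrict_apply hmeas, hset,
    Real.volume_preimage_mul_left hw.ne', measure_preimage_add, abs_of_pos (inv_pos.2 hw),
    ← mul_assoc, ← ENNReal.ofReal_mul hw.le, mul_inv_cancel₀ hw.ne', ENNReal.ofReal_one, one_mul]
  apply measure_congr
  rw [Set.inter_comm]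
  exact (Ioo_ae_eq_Ico.symm).inter Filter.EventuallyEq.rfl

theorem measurable_bandDensity (m : ℕ) (p : unitInterval) : Measurable (bandDensity m p) := by
  refine (measurable_gaussianPDFReal 0 1).mul (Finset.measurable_fun_sum _ fun k _ => ?_)
  exact (measurable_const.indicator measurableSet_Ioo).comp continuous_stdNormalCDF.measurable

theorem bandDensity_nonneg (m : ℕ) (p : unitInterval) (z : ℝ) : 0 ≤ bandDensity m p z :=
  mul_nonneg (gaussianPDFReal_nonneg _ _ _)
    (Finset.sum_nonneg fun k _ => Set.indicator_nonneg (fun _ _ => binomialRatio_nonneg m p k) _)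

theorem volume_band_inter_quantile_preimage {m k : ℕ} (hk : k ≤ m) {A : Set ℝ}
    (hA : MeasurableSet A) :
    volume (Set.Ioo (fairCDF m k) (fairCDF m (k + 1)) ∩ stdNormalQuantile ⁻¹' A) =
      gaussianReal 0 1 (A ∩ stdNormalCDF ⁻¹' Set.Ioo (fairCDF m k) (fairCDF m (k + 1))) := by
  have hB : MeasurableSet (stdNormalCDF ⁻¹' Set.Ioo (fairCDF m k) (fairCDF m (k + 1))) :=
    continuous_stdNormalCDF.measurable measurableSet_Ioo
  rw [← map_stdNormalQuantile, Measure.map_apply measurable_stdNormalQuantile (hA.inter hB),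
    Measure.restrict_apply (measurable_stdNormalQuantile (hA.inter hB))]
  congr 1
  ext u
  simp only [Set.mem_inter_iff, Set.mem_preimage]
  constructor
  · rintro ⟨hu, huA⟩
    have hu01 : u ∈ Set.Ioo (0 : ℝ) 1 :=
      ⟨(fairCDF_nonneg m k).trans_lt hu.1, hu.2.trans_le (fairCDF_le_one (by omega))⟩
    rw [stdNormalCDF_stdNormalQuantile hu01.1 hu01.2]
    exact ⟨⟨huA, hu⟩, hu01⟩
  · rintro ⟨⟨huA, hu⟩, hu01⟩
    rw [stdNormalCDF_stdNormalQuantile hu01.1 hu01.2] at hu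
    exact ⟨hu, huA⟩

theorem map_quantileCoupling (m : ℕ) (p : unitInterval) :
    ((binomial m p).prod uniformNoise).map (quantileCoupling m) =
      volume.withDensity (fun z => ENNReal.ofReal (bandDensity m p z)) := by
  ext A hA
  rw [Measure.map_apply (measurable_quantileCoupling m) hA,
    binomial_prod_apply _ _ _ (measurable_quantileCoupling m hA), withDensity_apply _ hA]
  have hB : ∀ k, MeasurableSet (stdNormalCDF ⁻¹' Set.Ioo (fairCDF m k) (fairCDF m (k + 1))) :=
    fun k => continuous_stdNormalCDF.measurable measurableSet_Ioo
  have hdens : ∀ z, ENNReal.ofReal (bandDensity m p z) = ∑ k ∈ Finset.range (m + 1),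
      ENNReal.ofReal (binomialRatio m p k) *
        (stdNormalCDF ⁻¹' Set.Ioo (fairCDF m k) (fairCDF m (k + 1))).indicator
          (gaussianPDF 0 1) z := by
    intro z
    rw [bandDensity, Finset.mul_sum, ENNReal.ofReal_sum_of_nonneg]
    · refine Finset.sum_congr rfl fun k _ => ?_
      by_cases hz : z ∈ stdNormalCDF ⁻¹' Set.Ioo (fairCDF m k) (fairCDF m (k + 1))
      · rw [Set.indicator_of_mem hz, Set.indicator_of_mem (by exact hz), mul_comm,
          ENNReal.ofReal_mul (binomialRatio_nonneg m p k)]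
        rfl
      · rw [Set.indicator_of_notMem hz, Set.indicator_of_notMem (by exact hz)]
        simp
    · exact fun k _ => mul_nonneg (gaussianPDFReal_nonneg _ _ _)
        (Set.indicator_nonneg (fun _ _ => binomialRatio_nonneg m p k) _)
  simp only [hdens]
  rw [lintegral_finsetSum]
  · refine Finset.sum_congr rfl fun k hk => ?_
    have hkm : k ≤ m := by simpa [Nat.lt_succ_iff] using hk
    rw [lintegral_const_mul _ ((measurable_gaussianPDF 0 1).indicator (hB k)),
      lintegral_indicator (hB k), Measure.restrict_restrict (hB k),
      ← gaussianReal_apply 0 one_ne_zero, Set.inter_comm,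
      ← volume_band_inter_quantile_preimage hkm hA,
      ← fairWeight_mul_uniformNoise hkm (measurable_stdNormalQuantile hA),
      ENNReal.ofReal_mul (binomialRatio_nonneg m p k), mul_assoc]
    congr 2
    unfold uniformNoise
    refine measure_congr ?_
    filter_upwards [ae_restrict_mem measurableSet_Ico] with u hu
    have : quantileCoupling m (k, u) =
        stdNormalQuantile (fairCDF m k + fairWeight m k * (u + 1 / 2)) := by
      rw [quantileCoupling, binomialSmoothCDF_add hkm hu]
    change (quantileCoupling m (k, u) ∈ A) =
      (stdNormalQuantile (fairCDF m k + fairWeight m k * (u + 1 / 2)) ∈ A)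
    rw [this]
  · exact fun k _ => ((measurable_gaussianPDF 0 1).indicator (hB k)).const_mul _

theorem lintegral_bandDensity (m : ℕ) (p : unitInterval) :
    ∫⁻ z, ENNReal.ofReal (bandDensity m p z) = 1 := by
  have h := congrArg (fun μ => μ Set.univ) (map_quantileCoupling m p)
  simp only [withDensity_apply _ MeasurableSet.univ, Measure.restrict_univ] at h
  rw [← h, Measure.map_apply (measurable_quantileCoupling m) MeasurableSet.univ,
    Set.preimage_univ, measure_univ]

theorem integrable_bandDensity (m : ℕ) (p : unitInterval) : Integrable (bandDensity m p) := by
  refine ⟨(measurable_bandDensity m p).aestronglyMeasurable, ?_⟩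
  rw [hasFiniteIntegral_iff_ofReal (Filter.Eventually.of_forall (bandDensity_nonneg m p)),
    lintegral_bandDensity]
  exact ENNReal.one_lt_top

theorem integral_bandDensity (m : ℕ) (p : unitInterval) : ∫ z, bandDensity m p z = 1 := by
  rw [integral_eq_lintegral_of_nonneg_ae (Filter.Eventually.of_forall (bandDensity_nonneg m p))
    (measurable_bandDensity m p).aestronglyMeasurable, lintegral_bandDensity, ENNReal.toReal_one]

theorem transformedCDF_eq_integral (m : ℕ) (p : unitInterval) (z : ℝ) :
    transformedCDF m p z = ∫ y in Set.Iic z, bandDensity m p y := by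
  have h1 : ((binomial m p).prod uniformNoise) {q | quantileCoupling m q ≤ z} =
      ∫⁻ y in Set.Iic z, ENNReal.ofReal (bandDensity m p y) := by
    rw [← withDensity_apply _ measurableSet_Iic, ← map_quantileCoupling,
      Measure.map_apply (measurable_quantileCoupling m) measurableSet_Iic]
    rfl
  rw [transformedCDF, measureReal_def, h1, integral_eq_lintegral_of_nonneg_ae
    (Filter.Eventually.of_forall (bandDensity_nonneg m p))
    (measurable_bandDensity m p).aestronglyMeasurable]

theorem bandDensity_of_mem {m k : ℕ} (hk : k ≤ m) (p : unitInterval) {z : ℝ}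
    (hz : stdNormalCDF z ∈ Set.Ioo (fairCDF m k) (fairCDF m (k + 1))) :
    bandDensity m p z = stdNormalPDF z * binomialRatio m p k := by
  rw [bandDensity, Finset.sum_eq_single k, Set.indicator_of_mem hz]
  · intro j _ hjk
    refine Set.indicator_of_notMem (fun hj => ?_) _
    rcases lt_or_gt_of_ne hjk with h | h
    · exact absurd (monotone_fairCDF m (show j + 1 ≤ k from h)) (not_le.2 (hz.1.trans hj.2))
    · exact absurd (monotone_fairCDF m (show k + 1 ≤ j from h)) (not_le.2 (hj.1.trans hz.2))
  · intro h
    simp at h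
    omega

/-- Almost every point lies in the interior of one of the bands. -/
theorem ae_exists_mem_band (m : ℕ) :
    ∀ᵐ z : ℝ, ∃ k ≤ m, stdNormalCDF z ∈ Set.Ioo (fairCDF m k) (fairCDF m (k + 1)) := by
  have hfin : (⋃ k ∈ Finset.range (m + 2), stdNormalCDF ⁻¹' {fairCDF m k}).Finite :=
    Set.Finite.biUnion (Finset.finite_toSet _) fun k _ =>
      (Set.finite_singleton _).preimage strictMono_stdNormalCDF.injective.injOn
  filter_upwards [compl_mem_ae_iff.2 (hfin.measure_zero volume)] with z hz
  have hne : ∀ k ≤ m + 1, stdNormalCDF z ≠ fairCDF m k := by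
    intro k hk h
    refine hz ?_
    simp only [Set.mem_iUnion]
    exact ⟨k, Finset.mem_range.2 (by omega), h⟩
  have hex : ∃ k, stdNormalCDF z < fairCDF m k :=
    ⟨m + 1, by rw [fairCDF_last]; exact stdNormalCDF_lt_one z⟩
  have hspec := Nat.find_spec hex
  have hle : Nat.find hex ≤ m + 1 :=
    Nat.find_min' hex (by rw [fairCDF_last]; exact stdNormalCDF_lt_one z)
  have hpos : Nat.find hex ≠ 0 := by
    intro h0
    rw [h0, fairCDF_zero] at hspec
    exact absurd hspec (not_lt.2 (stdNormalCDF_pos z).le)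
  obtain ⟨k, hk⟩ := Nat.exists_eq_succ_of_ne_zero hpos
  have hmin := Nat.find_min hex (m := k) (by omega)
  rw [hk] at hspec
  refine ⟨k, by omega, lt_of_le_of_ne (not_lt.1 hmin) (hne k (by omega)).symm, hspec⟩

/-- Inside an open band the density is a constant multiple of `stdNormalPDF`, hence continuous, so
the fundamental theorem of calculus identifies the derivative. -/
theorem transformedDensity_of_mem {m k : ℕ} (hk : k ≤ m) (p : unitInterval) {z : ℝ}
    (hz : stdNormalCDF z ∈ Set.Ioo (fairCDF m k) (fairCDF m (k + 1))) :
    transformedDensity m p z = bandDensity m p z := by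
  have hint := (integrable_bandDensity m p)
  have hcdf : transformedCDF m p =
      fun x => transformedCDF m p z + ∫ y in z..x, bandDensity m p y := by
    funext x
    rw [transformedCDF_eq_integral, transformedCDF_eq_integral,
      ← intervalIntegral.integral_Iic_sub_Iic hint.integrableOn hint.integrableOn]
    ring
  have hcont : ContinuousAt (bandDensity m p) z := by
    have hev : (fun y => stdNormalPDF y * binomialRatio m p k) =ᶠ[nhds z] bandDensity m p := by
      filter_upwards [continuous_stdNormalCDF.continuousAt.preimage_mem_nhds
        (isOpen_Ioo.mem_nhds hz)] with y hy
      exact (bandDensity_of_mem hk p hy).symm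
    exact ((continuous_gaussianPDFReal_one 0).continuousAt.mul continuousAt_const).congr hev
  rw [transformedDensity, hcdf]
  exact ((intervalIntegral.integral_hasDerivAt_right hint.intervalIntegrable
    (measurable_bandDensity m p).stronglyMeasurable.stronglyMeasurableAtFilter
    hcont).const_add _).deriv

theorem transformedDensity_ae_eq (m : ℕ) (p : unitInterval) :
    transformedDensity m p =ᵐ[volume] bandDensity m p := by
  filter_upwards [ae_exists_mem_band m] with z ⟨k, hk, hz⟩
  exact transformedDensity_of_mem hk p hz

theorem map_quantileCoupling_eq_withDensity (m : ℕ) (p : unitInterval) :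
    ((binomial m p).prod uniformNoise).map (quantileCoupling m) =
      volume.withDensity (fun z => ENNReal.ofReal (transformedDensity m p z)) := by
  rw [map_quantileCoupling]
  refine withDensity_congr_ae ?_
  filter_upwards [transformedDensity_ae_eq m p] with z hz
  rw [hz]

/-! ### The log-likelihood ratio and a Gaussian envelope -/

theorem sq_exp_sub_one_le (x : ℝ) : (Real.exp x - 1) ^ 2 ≤ x ^ 2 * (Real.exp (2 * x) + 1) := by
  have e : Real.exp (2 * x) = Real.exp x ^ 2 := by rw [sq, ← Real.exp_add]; congr 1; ring
  have hp := Real.exp_pos x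
  have h1 := Real.add_one_le_exp x
  rw [e]
  rcases le_total 0 x with hx | hx
  · have h2 : Real.exp x - 1 ≤ x * Real.exp x := by
      have h3 := mul_le_mul_of_nonneg_right (Real.add_one_le_exp (-x)) hp.le
      rw [← Real.exp_add, neg_add_cancel, Real.exp_zero] at h3
      linarith
    have h4 : (Real.exp x - 1) ^ 2 ≤ (x * Real.exp x) ^ 2 :=
      pow_le_pow_left₀ (by linarith) h2 2
    nlinarith [sq_nonneg x]
  · have h2 : Real.exp x ≤ 1 := Real.exp_le_one_iff.2 hx
    have h4 : (1 - Real.exp x) ^ 2 ≤ (-x) ^ 2 := pow_le_pow_left₀ (by linarith) (by linarith) 2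
    nlinarith [sq_nonneg (x * Real.exp x)]

theorem sq_sqrt_sub_sqrt_le_of_log_ratio {f g L : ℝ} (hf : 0 ≤ f) (hg : g = f * Real.exp L) :
    (√g - √f) ^ 2 ≤ L ^ 2 / 4 * (g + f) := by
  have e : √g = √f * Real.exp (L / 2) := by
    rw [hg, Real.sqrt_mul hf]
    congr 1
    rw [Real.sqrt_eq_iff_mul_self_eq (Real.exp_pos _).le (Real.exp_pos _).le, ← Real.exp_add]
    congr 1
    ring
  have h := sq_exp_sub_one_le (L / 2)
  rw [mul_div_cancel₀ L two_ne_zero] at h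
  calc (√g - √f) ^ 2 = f * (Real.exp (L / 2) - 1) ^ 2 := by
        rw [e]
        nth_rewrite 3 [← Real.sq_sqrt hf]
        ring
    _ ≤ f * ((L / 2) ^ 2 * (Real.exp L + 1)) := by gcongr
    _ = _ := by rw [hg]; ring

theorem one_add_half_sq_le_cosh (t : ℝ) : 1 + t ^ 2 / 2 ≤ Real.cosh t := by
  have h1 : Real.cosh t = 1 + 2 * Real.sinh (|t| / 2) ^ 2 := by
    rw [← Real.cosh_abs, show |t| = 2 * (|t| / 2) by ring, Real.cosh_two_mul, Real.cosh_sq]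
    ring_nf
  have h2 : |t| / 2 ≤ Real.sinh (|t| / 2) := Real.self_le_sinh_iff.2 (by positivity)
  have h3 : (|t| / 2) ^ 2 ≤ Real.sinh (|t| / 2) ^ 2 := pow_le_pow_left₀ (by positivity) h2 2
  rw [div_pow, sq_abs] at h3
  linarith

theorem log_cosh_le (t : ℝ) : Real.log (Real.cosh t) ≤ t ^ 2 / 2 := by
  rw [Real.log_le_iff_le_exp (Real.cosh_pos t)]
  exact Real.cosh_le_exp_half_sq t

theorem le_log_cosh (t : ℝ) : t ^ 2 / 2 - t ^ 4 / 4 ≤ Real.log (Real.cosh t) := by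
  have hp : 0 < 1 + t ^ 2 / 2 := by positivity
  have h1 := Real.log_le_log hp (one_add_half_sq_le_cosh t)
  have h2 := Real.one_sub_inv_le_log_of_pos hp
  have h3 : t ^ 2 / 2 - t ^ 4 / 4 ≤ 1 - (1 + t ^ 2 / 2)⁻¹ := by
    have e : 1 - (1 + t ^ 2 / 2)⁻¹ = (t ^ 2 / 2) / (1 + t ^ 2 / 2) := by
      field_simp
      ring
    rw [e, le_div_iff₀ hp]
    have : 0 ≤ t ^ 6 := by positivity
    nlinarith
  linarith

/-- Exponential tilting: `2p = e^t / cosh t` and `2(1 - p) = e^{-t} / cosh t`. -/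
theorem binomialRatio_eq {m k : ℕ} (hk : k ≤ m) {p : unitInterval} (hp0 : 0 < p) (hp1 : p < 1)
    {t : ℝ} (ht : t = Real.log ((p : ℝ) / (1 - (p : ℝ))) / 2) :
    binomialRatio m p k =
      Real.exp (t * (2 * k - m) - m * Real.log (Real.cosh t)) := by
  have hp0' : 0 < (p : ℝ) := hp0
  have hq0' : 0 < 1 - (p : ℝ) := sub_pos.2 hp1
  have hc := Real.cosh_pos t
  have hE := Real.exp_pos t
  have h2t : Real.exp t * Real.exp t = p / (1 - p) := by
    rw [← Real.exp_add, ht, add_halves, Real.exp_log (by positivity)]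
  rw [eq_div_iff hq0'.ne'] at h2t
  have hcosh : Real.cosh t = (Real.exp t + (Real.exp t)⁻¹) / 2 := by
    rw [Real.cosh_eq, Real.exp_neg]
  have h1 : 2 * (p : ℝ) = Real.exp t / Real.cosh t := by
    rw [eq_div_iff hc.ne', hcosh]
    field_simp
    linarith
  have h2 : 2 * (1 - (p : ℝ)) = Real.exp (-t) / Real.cosh t := by
    rw [eq_div_iff hc.ne', hcosh, Real.exp_neg]
    field_simp
    linarith
  have hm : (m : ℝ) = k + (m - k : ℕ) := by rw [Nat.cast_sub hk]; ring
  have hcm : Real.cosh t ^ m = Real.cosh t ^ k * Real.cosh t ^ (m - k) := by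
    rw [← pow_add]; congr 1; omega
  rw [binomialRatio, h1, h2, div_pow, div_pow, Real.exp_sub, ← Real.exp_nat_mul,
    ← Real.exp_nat_mul, div_mul_div_comm, ← Real.exp_add, ← hcm, Real.exp_nat_mul,
    Real.exp_log hc]
  congr 2
  rw [hm]
  ring

theorem gaussianPDFReal_one_le_exp (b z : ℝ) :
    gaussianPDFReal b 1 z ≤ Real.exp (-(z - b) ^ 2 / 2) := by
  rw [gaussianPDFReal_one_eq]
  refine mul_le_of_le_one_left (Real.exp_pos _).le (inv_le_one_of_one_le₀ ?_)
  rw [Real.one_le_sqrt]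
  linarith [Real.pi_gt_three]

theorem gaussianPDFReal_one_eq_mul_exp (b z : ℝ) :
    gaussianPDFReal b 1 z = stdNormalPDF z * Real.exp (b * z - b ^ 2 / 2) := by
  rw [stdNormalPDF, gaussianPDFReal_one_eq, gaussianPDFReal_one_eq, mul_assoc, ← Real.exp_add]
  congr 2
  ring

theorem abs_two_mul_sub_le {m k : ℕ} (hk : k ≤ m) : |(2 * k - m : ℝ)| ≤ m := by
  have : (k : ℝ) ≤ m := by exact_mod_cast hk
  rw [abs_le]
  constructor <;> linarith [(Nat.cast_nonneg k : (0 : ℝ) ≤ k)]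

/-- The log-likelihood ratio of the transformed density to the normal density with mean
`√m t`, on the band of `k`. -/
noncomputable def logRatio (m k : ℕ) (t z : ℝ) : ℝ :=
  m * (t ^ 2 / 2 - Real.log (Real.cosh t)) + √m * t * ((2 * k - m) / √m - z)

theorem bandDensity_eq_mul_exp_logRatio {m k : ℕ} (hm : 0 < m) (hk : k ≤ m) {p : unitInterval}
    (hp0 : 0 < p) (hp1 : p < 1) {t z : ℝ} (ht : t = Real.log ((p : ℝ) / (1 - (p : ℝ))) / 2)
    (hz : stdNormalCDF z ∈ Set.Ioo (fairCDF m k) (fairCDF m (k + 1))) :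
    bandDensity m p z = gaussianPDFReal (√m * t) 1 z * Real.exp (logRatio m k t z) := by
  have hm' : (0 : ℝ) < m := by exact_mod_cast hm
  have hs : 0 < √(m : ℝ) := Real.sqrt_pos.2 hm'
  have hss : √(m : ℝ) ^ 2 = m := Real.sq_sqrt hm'.le
  rw [bandDensity_of_mem hk p hz, binomialRatio_eq hk hp0 hp1 ht, gaussianPDFReal_one_eq_mul_exp,
    mul_assoc, ← Real.exp_add]
  congr 2
  have e : √m * t * ((2 * k - m) / √m - z) = t * (2 * k - m) - √m * t * z := by
    field_simp
  rw [logRatio, e, mul_pow, hss]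
  ring

/-- The coupling estimate contributes `b²(1/m + z⁶/m²) = t² + t² z⁶/m`. Expanding `z` around `b`
splits `z⁶` into `y⁶`, to be integrated, and `b⁶`, for which `t² b⁶/m = m² t⁸`. -/
theorem sq_logRatio_le {m k : ℕ} (hm : 0 < m) (hk : k ≤ m) {t z : ℝ}
    (h0 : fairCDF m k ≤ stdNormalCDF z) (h1 : stdNormalCDF z ≤ fairCDF m (k + 1)) :
    logRatio m k t z ^ 2 / 4 ≤
      33 * (10 ^ 14) ^ 2 * (t ^ 2 + m ^ 2 * t ^ 8) * (1 + (z - √m * t) ^ 6) := by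
  have hm' : (0 : ℝ) < m := by exact_mod_cast hm
  have hm1 : (1 : ℝ) ≤ m := by exact_mod_cast hm
  have hs : 0 < √(m : ℝ) := Real.sqrt_pos.2 hm'
  have hss : √(m : ℝ) ^ 2 = m := Real.sq_sqrt hm'.le
  have hc := abs_sub_le_of_mem_band hm hk h0 h1
  set w : ℝ := (2 * k - m) / √m
  set κ := (m : ℝ) * (t ^ 2 / 2 - Real.log (Real.cosh t)) with hκ
  set b := √(m : ℝ) * t with hb
  set y := z - b
  have hκ0 : 0 ≤ κ := mul_nonneg hm'.le (by linarith [log_cosh_le t])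
  have hκ1 : κ ≤ m * t ^ 4 / 4 := by
    rw [hκ, mul_div_assoc]
    gcongr
    linarith [le_log_cosh t]
  have hκ2 : κ ^ 2 ≤ m ^ 2 * t ^ 8 / 16 := by
    refine (pow_le_pow_left₀ hκ0 hκ1 2).trans_eq ?_
    ring
  have hb2 : b ^ 2 = m * t ^ 2 := by rw [hb, mul_pow, hss]
  have hwz : (w - z) ^ 2 ≤ 2 * (10 ^ 14) ^ 2 * (1 / m + z ^ 6 / m ^ 2) := by
    have h2 : |w - z| ^ 2 ≤ (10 ^ 14 * (1 / √m + |z| ^ 3 / m)) ^ 2 :=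
      pow_le_pow_left₀ (abs_nonneg _) hc 2
    have h3 : (1 / √m + |z| ^ 3 / m) ^ 2 ≤ 2 * (1 / m + z ^ 6 / m ^ 2) := by
      have e1 : (1 / √(m : ℝ)) ^ 2 = 1 / m := by rw [div_pow, hss, one_pow]
      have e2 : (|z| ^ 3 / (m : ℝ)) ^ 2 = z ^ 6 / m ^ 2 := by
        rw [div_pow, ← pow_mul, show 3 * 2 = 2 * 3 from rfl, pow_mul, sq_abs, ← pow_mul]
      rw [← e1, ← e2]
      exact add_sq_le
    rw [sq_abs, mul_pow] at h2
    refine h2.trans ?_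
    rw [mul_comm 2, mul_assoc]
    exact mul_le_mul_of_nonneg_left h3 (by positivity)
  have hz6 : z ^ 6 ≤ 32 * (y ^ 6 + b ^ 6) := by
    have e : z ^ 2 ≤ 2 * (y ^ 2 + b ^ 2) := by
      have : z = y + b := by ring
      rw [this]
      exact add_sq_le
    have e2 : (z ^ 2) ^ 3 ≤ (2 * (y ^ 2 + b ^ 2)) ^ 3 := pow_le_pow_left₀ (sq_nonneg z) e 3
    have e3 : (y ^ 2 + b ^ 2) ^ 3 ≤ 4 * ((y ^ 2) ^ 3 + (b ^ 2) ^ 3) := by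
      nlinarith [mul_nonneg (add_nonneg (sq_nonneg y) (sq_nonneg b)) (sq_nonneg (y ^ 2 - b ^ 2))]
    nlinarith
  have hb6 : b ^ 6 = m ^ 3 * t ^ 6 := by
    calc b ^ 6 = (b ^ 2) ^ 3 := by ring
      _ = _ := by rw [hb2]; ring
  have hy : 0 ≤ y ^ 6 := by positivity
  have hL : logRatio m k t z ^ 2 ≤ 2 * (κ ^ 2 + b ^ 2 * (w - z) ^ 2) := by
    have : logRatio m k t z = κ + b * (w - z) := rfl
    rw [this, ← mul_pow]
    exact add_sq_le
  have hb2wz : b ^ 2 * (w - z) ^ 2 ≤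
      2 * (10 ^ 14) ^ 2 * (t ^ 2 + 32 * (t ^ 2 * y ^ 6 + m ^ 2 * t ^ 8)) := by
    have h2 : b ^ 2 * (1 / m + z ^ 6 / m ^ 2) ≤
        t ^ 2 + 32 * (t ^ 2 * y ^ 6 + m ^ 2 * t ^ 8) := by
      have e1 : b ^ 2 * (1 / m + z ^ 6 / m ^ 2) = t ^ 2 + t ^ 2 * z ^ 6 / m := by
        rw [hb2]; field_simp
      have e2 : t ^ 2 * z ^ 6 / m ≤ t ^ 2 * (32 * (y ^ 6 + m ^ 3 * t ^ 6)) / m := by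
        rw [← hb6]; gcongr
      have e3 : t ^ 2 * (32 * (y ^ 6 + m ^ 3 * t ^ 6)) / m =
          32 * (t ^ 2 * y ^ 6 / m + m ^ 2 * t ^ 8) := by
        field_simp
      have e4 : t ^ 2 * y ^ 6 / m ≤ t ^ 2 * y ^ 6 := div_le_self (by positivity) hm1
      linarith
    calc b ^ 2 * (w - z) ^ 2 ≤ b ^ 2 * (2 * (10 ^ 14) ^ 2 * (1 / m + z ^ 6 / m ^ 2)) := by gcongr
      _ = 2 * (10 ^ 14) ^ 2 * (b ^ 2 * (1 / m + z ^ 6 / m ^ 2)) := by ring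
      _ ≤ _ := by gcongr
  have ht2 : 0 ≤ t ^ 2 := sq_nonneg t
  have ht8 : 0 ≤ m ^ 2 * t ^ 8 := by positivity
  have hty : 0 ≤ t ^ 2 * y ^ 6 := by positivity
  have hty' : 0 ≤ m ^ 2 * t ^ 8 * y ^ 6 := by positivity
  linarith

/-- Bounding `L` by a small multiple of `y²` keeps Gaussian decay after multiplication by `e^L`. The
threshold `10 ^ 16` beats the coupling constant `10 ^ 14` by enough that the coefficient of `y²`
stays below `1/4`. -/
theorem logRatio_le {m k : ℕ} (hm : 0 < m) (hk : k ≤ m) {t z : ℝ} (ht : 10 ^ 16 * |t| ≤ 1)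
    (htm : 10 ^ 16 * (m * t ^ 4) ≤ 1) (hz : |z| ≤ √m)
    (h0 : fairCDF m k ≤ stdNormalCDF z) (h1 : stdNormalCDF z ≤ fairCDF m (k + 1)) :
    logRatio m k t z ≤ 3 + (z - √m * t) ^ 2 / 4 := by
  have hm' : (0 : ℝ) < m := by exact_mod_cast hm
  have hs : 0 < √(m : ℝ) := Real.sqrt_pos.2 hm'
  have hss : √(m : ℝ) ^ 2 = m := Real.sq_sqrt hm'.le
  have hc := abs_sub_le_of_mem_band hm hk h0 h1
  rw [logRatio]
  set w : ℝ := (2 * k - m) / √m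
  set b := √(m : ℝ) * t with hb
  set y := z - b with hy
  have hκ1 : m * (t ^ 2 / 2 - Real.log (Real.cosh t)) ≤ m * t ^ 4 / 4 := by
    rw [mul_div_assoc]
    gcongr
    linarith [le_log_cosh t]
  have hbabs : |b| = √m * |t| := by rw [hb, abs_mul, abs_of_pos hs]
  have hmain : b * (w - z) ≤ 10 ^ 14 * (|t| + |t| * |z| ^ 3 / √m) := by
    calc b * (w - z) ≤ |b| * |w - z| := by rw [← abs_mul]; exact le_abs_self _
      _ ≤ |b| * (10 ^ 14 * (1 / √m + |z| ^ 3 / m)) := by gcongr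
      _ = _ := by
        rw [hbabs]
        nth_rewrite 3 [← hss]
        field_simp
  have hzy : |z| ≤ |y| + √m * |t| := by
    rw [← hbabs]
    have : z = y + b := by rw [hy]; ring
    rw [this]
    exact abs_add_le y b
  have hcube : |z| ^ 3 ≤ 4 * (|y| ^ 3 + (√m * |t|) ^ 3) := by
    have h2 : |z| ^ 3 ≤ (|y| + √m * |t|) ^ 3 := pow_le_pow_left₀ (abs_nonneg _) hzy 3
    have h3 : 0 ≤ √m * |t| := by positivity
    nlinarith [mul_nonneg (add_nonneg (abs_nonneg y) h3) (sq_nonneg (|y| - √m * |t|))]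
  have ht1 : |t| ≤ 1 := by linarith [abs_nonneg t]
  have hy3 : |y| ^ 3 ≤ 2 * √m * y ^ 2 := by
    have h2 : |y| ≤ 2 * √m := by
      calc |y| ≤ |z| + |b| := abs_sub _ _
        _ ≤ √m + √m * 1 := by rw [hbabs]; gcongr
        _ = _ := by ring
    rw [← sq_abs y]
    nlinarith [mul_le_mul_of_nonneg_left h2 (sq_nonneg |y|)]
  have hfin : |t| * |z| ^ 3 / √m ≤ 8 * (|t| * y ^ 2) + 4 * (m * t ^ 4) := by
    calc |t| * |z| ^ 3 / √m ≤ |t| * (4 * (2 * √m * y ^ 2 + (√m * |t|) ^ 3)) / √m := by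
          gcongr
          linarith
      _ = 8 * (|t| * y ^ 2) + 4 * (√m ^ 2 * (|t| ^ 2) ^ 2) := by field_simp; ring
      _ = _ := by rw [hss, sq_abs]; ring
  have hty : 10 ^ 16 * (|t| * y ^ 2) ≤ y ^ 2 := by
    have := mul_le_mul_of_nonneg_right ht (sq_nonneg y)
    linarith
  linarith [sq_nonneg y]

theorem bandDensity_add_le {m k : ℕ} (hm : 0 < m) (hk : k ≤ m) {p : unitInterval}
    (hp0 : 0 < p) (hp1 : p < 1) {t z : ℝ} (ht : t = Real.log ((p : ℝ) / (1 - (p : ℝ))) / 2)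
    (ht1 : 10 ^ 16 * |t| ≤ 1) (htm : 10 ^ 16 * (m * t ^ 4) ≤ 1)
    (hz : stdNormalCDF z ∈ Set.Ioo (fairCDF m k) (fairCDF m (k + 1))) :
    bandDensity m p z + gaussianPDFReal (√m * t) 1 z ≤
      (1 + Real.exp 3) * Real.exp (-(z - √m * t) ^ 2 / 8) := by
  have hm' : (0 : ℝ) < m := by exact_mod_cast hm
  have hs : 0 < √(m : ℝ) := Real.sqrt_pos.2 hm'
  have hss : √(m : ℝ) ^ 2 = m := Real.sq_sqrt hm'.le
  have hgauss : gaussianPDFReal (√m * t) 1 z ≤ Real.exp (-(z - √m * t) ^ 2 / 8) := by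
    refine (gaussianPDFReal_one_le_exp _ _).trans (Real.exp_le_exp.2 ?_)
    linarith [sq_nonneg (z - √m * t)]
  have hband : bandDensity m p z ≤ Real.exp 3 * Real.exp (-(z - √m * t) ^ 2 / 8) := by
    rcases le_or_gt |z| (√m) with hzm | hzm
    · rw [bandDensity_eq_mul_exp_logRatio hm hk hp0 hp1 ht hz]
      have h1 := logRatio_le hm hk ht1 htm hzm hz.1.le hz.2.le
      calc _ ≤ Real.exp (-(z - √m * t) ^ 2 / 2) * Real.exp (logRatio m k t z) := by
            gcongr
            exact gaussianPDFReal_one_le_exp _ _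
        _ ≤ _ := by
            rw [← Real.exp_add, ← Real.exp_add]
            apply Real.exp_le_exp.2
            linarith [sq_nonneg (z - √m * t)]
    -- Far out no coupling is needed: `|2k - m| ≤ m ≤ z²`, so the tilt is a small multiple of `z²`,
    -- absorbed by the normal density.
    · rw [bandDensity_of_mem hk p hz, binomialRatio_eq hk hp0 hp1 ht]
      have hmz : (m : ℝ) ≤ z ^ 2 := by
        rw [← hss, ← sq_abs z]
        exact pow_le_pow_left₀ hs.le hzm.le 2
      have ht16 : |t| ≤ 1 / 16 := by linarith [abs_nonneg t]
      have h1 : t * (2 * k - m) ≤ z ^ 2 / 16 := by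
        calc t * (2 * k - m) ≤ |t| * |(2 * k - m : ℝ)| := by rw [← abs_mul]; exact le_abs_self _
          _ ≤ 1 / 16 * z ^ 2 := by
            gcongr
            exact (abs_two_mul_sub_le hk).trans hmz
          _ = _ := by ring
      have h2 : 0 ≤ m * Real.log (Real.cosh t) :=
        mul_nonneg hm'.le (Real.log_nonneg (Real.one_le_cosh t))
      have h3 : (√m * t) ^ 2 ≤ z ^ 2 / 16 := by
        rw [mul_pow, hss, ← sq_abs t]
        have : |t| ^ 2 ≤ 1 / 16 := by nlinarith [abs_nonneg t]
        nlinarith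
      have h4 : (z - √m * t) ^ 2 ≤ 2 * (z ^ 2 + (√m * t) ^ 2) := by
        nlinarith [sq_nonneg (z + √m * t)]
      have h5 := gaussianPDFReal_one_le_exp 0 z
      calc _ ≤ Real.exp (-(z - 0) ^ 2 / 2) *
            Real.exp (t * (2 * k - m) - m * Real.log (Real.cosh t)) := by gcongr
        _ ≤ _ := by
            rw [← Real.exp_add, ← Real.exp_add]
            apply Real.exp_le_exp.2
            rw [sub_zero]
            linarith [sq_nonneg z]
  linarith

theorem one_add_pow_six_mul_exp_le (y : ℝ) :
    (1 + y ^ 6) * Real.exp (-y ^ 2 / 8) ≤ 24577 * Real.exp (-y ^ 2 / 16) := by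
  have h1 := Real.pow_div_factorial_le_exp (y ^ 2 / 16) (by positivity) 3
  have h2 : 1 ≤ Real.exp (y ^ 2 / 16) := Real.one_le_exp (by positivity)
  have e : Nat.factorial 3 = 6 := rfl
  rw [e] at h1
  -- The constant is `1 + 3! * 16 ^ 3`.
  have h3 : 1 + y ^ 6 ≤ 24577 * Real.exp (y ^ 2 / 16) := by
    have : (y ^ 2 / 16) ^ 3 / ((6 : ℕ) : ℝ) = y ^ 6 / 24576 := by push_cast; ring
    linarith
  calc _ ≤ 24577 * Real.exp (y ^ 2 / 16) * Real.exp (-y ^ 2 / 8) := by gcongr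
    _ = _ := by
      rw [mul_assoc, ← Real.exp_add]
      congr 2
      ring

theorem sq_sqrt_bandDensity_sub_le {m k : ℕ} (hm : 0 < m) (hk : k ≤ m) {p : unitInterval}
    (hp0 : 0 < p) (hp1 : p < 1) {t z : ℝ} (ht : t = Real.log ((p : ℝ) / (1 - (p : ℝ))) / 2)
    (ht1 : 10 ^ 16 * |t| ≤ 1) (htm : 10 ^ 16 * (m * t ^ 4) ≤ 1)
    (hz : stdNormalCDF z ∈ Set.Ioo (fairCDF m k) (fairCDF m (k + 1))) :
    (√(bandDensity m p z) - √(gaussianPDFReal (√m * t) 1 z)) ^ 2 ≤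
      33 * (10 ^ 14) ^ 2 * (1 + Real.exp 3) * 24577 * (t ^ 2 + m ^ 2 * t ^ 8) *
        Real.exp (-(z - √m * t) ^ 2 / 16) := by
  have h1 := sq_sqrt_sub_sqrt_le_of_log_ratio (gaussianPDFReal_nonneg _ _ _)
    (bandDensity_eq_mul_exp_logRatio hm hk hp0 hp1 ht hz)
  have h2 := sq_logRatio_le hm hk (t := t) hz.1.le hz.2.le
  have h3 := bandDensity_add_le hm hk hp0 hp1 ht ht1 htm hz
  have h4 := one_add_pow_six_mul_exp_le (z - √m * t)
  have h5 := bandDensity_nonneg m p z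
  have h6 := gaussianPDFReal_nonneg (√m * t) 1 z
  have h7 : 0 ≤ t ^ 2 + m ^ 2 * t ^ 8 := by positivity
  calc _ ≤ _ := h1
    _ ≤ (33 * (10 ^ 14) ^ 2 * (t ^ 2 + m ^ 2 * t ^ 8) * (1 + (z - √m * t) ^ 6)) *
        ((1 + Real.exp 3) * Real.exp (-(z - √m * t) ^ 2 / 8)) := by
      apply mul_le_mul h2 h3 (add_nonneg h5 h6)
      have : 0 ≤ (z - √m * t) ^ 6 := by positivity
      positivity
    _ = 33 * (10 ^ 14) ^ 2 * (t ^ 2 + m ^ 2 * t ^ 8) * (1 + Real.exp 3) *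
        ((1 + (z - √m * t) ^ 6) * Real.exp (-(z - √m * t) ^ 2 / 8)) := by ring
    _ ≤ 33 * (10 ^ 14) ^ 2 * (t ^ 2 + m ^ 2 * t ^ 8) * (1 + Real.exp 3) *
        (24577 * Real.exp (-(z - √m * t) ^ 2 / 16)) := by gcongr
    _ = _ := by ring

/-! ### Hellinger distances -/

theorem sq_sqrt_sub_sqrt_le_add {a b : ℝ} (ha : 0 ≤ a) (hb : 0 ≤ b) :
    (√a - √b) ^ 2 ≤ a + b := by
  have h1 := Real.sq_sqrt ha
  have h2 := Real.sq_sqrt hb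
  nlinarith [mul_nonneg (Real.sqrt_nonneg a) (Real.sqrt_nonneg b)]

/-- A probability density on the line, as a real function. -/
structure IsProbDensity (f : ℝ → ℝ) : Prop where
  nonneg : ∀ z, 0 ≤ f z
  measurable : Measurable f
  integrable : Integrable f
  integral_eq_one : ∫ z, f z = 1

theorem isProbDensity_gaussianPDFReal (b : ℝ) : IsProbDensity (gaussianPDFReal b 1) :=
  ⟨gaussianPDFReal_nonneg b 1, measurable_gaussianPDFReal b 1, integrable_gaussianPDFReal b 1,
    integral_gaussianPDFReal_eq_one b one_ne_zero⟩

theorem isProbDensity_bandDensity (m : ℕ) (p : unitInterval) : IsProbDensity (bandDensity m p) :=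
  ⟨bandDensity_nonneg m p, measurable_bandDensity m p, integrable_bandDensity m p,
    integral_bandDensity m p⟩

theorem IsProbDensity.integrable_hellinger {f g : ℝ → ℝ} (hf : IsProbDensity f)
    (hg : IsProbDensity g) : Integrable (fun z => (√(f z) - √(g z)) ^ 2) := by
  refine (hf.integrable.add hg.integrable).mono' ?_ (Filter.Eventually.of_forall fun z => ?_)
  · exact ((hf.measurable.sqrt.sub hg.measurable.sqrt).pow_const 2).aestronglyMeasurable
  · rw [Real.norm_of_nonneg (sq_nonneg _)]
    exact sq_sqrt_sub_sqrt_le_add (hf.nonneg z) (hg.nonneg z)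

theorem hellingerSq_le_two {f g : ℝ → ℝ} (hf : IsProbDensity f) (hg : IsProbDensity g) :
    hellingerSq f g ≤ 2 := by
  calc hellingerSq f g ≤ ∫ z, (f z + g z) :=
        integral_mono (hf.integrable_hellinger hg) (hf.integrable.add hg.integrable)
          fun z => sq_sqrt_sub_sqrt_le_add (hf.nonneg z) (hg.nonneg z)
    _ = 2 := by
      rw [integral_add hf.integrable hg.integrable, hf.integral_eq_one, hg.integral_eq_one]
      norm_num

theorem hellingerSq_triangle {f g h : ℝ → ℝ} (hf : IsProbDensity f) (hg : IsProbDensity g)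
    (hh : IsProbDensity h) :
    hellingerSq f h ≤ 2 * hellingerSq f g + 2 * hellingerSq g h := by
  have h1 := (hf.integrable_hellinger hg).const_mul 2
  have h2 := (hg.integrable_hellinger hh).const_mul 2
  unfold hellingerSq
  rw [← integral_const_mul, ← integral_const_mul, ← integral_add h1 h2]
  refine integral_mono (hf.integrable_hellinger hh) (h1.add h2) fun z => ?_
  have := add_sq_le (a := √(f z) - √(g z)) (b := √(g z) - √(h z))
  simp only [sub_add_sub_cancel] at this
  simpa only [mul_add] using this

/-- The geometric mean of the two densities is `exp(-(a - b)²/8)` times the normal density at the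
midpoint, so the distance equals `2 - 2 exp(-(a - b)²/8)`. -/
theorem hellingerSq_gaussianPDFReal_le (a b : ℝ) :
    hellingerSq (gaussianPDFReal a 1) (gaussianPDFReal b 1) ≤ (a - b) ^ 2 / 4 := by
  have hpt : ∀ z, (√(gaussianPDFReal a 1 z) - √(gaussianPDFReal b 1 z)) ^ 2 =
      gaussianPDFReal a 1 z + gaussianPDFReal b 1 z -
        2 * Real.exp (-(a - b) ^ 2 / 8) * gaussianPDFReal ((a + b) / 2) 1 z := by
    intro z
    have ha := gaussianPDFReal_nonneg a 1 z
    have hb := gaussianPDFReal_nonneg b 1 z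
    have hprod : √(gaussianPDFReal a 1 z) * √(gaussianPDFReal b 1 z) =
        Real.exp (-(a - b) ^ 2 / 8) * gaussianPDFReal ((a + b) / 2) 1 z := by
      rw [← Real.sqrt_mul ha, Real.sqrt_eq_iff_mul_self_eq (mul_nonneg ha hb)
        (mul_nonneg (Real.exp_pos _).le (gaussianPDFReal_nonneg _ _ _))]
      simp only [gaussianPDFReal_one_eq]
      have e : ∀ c x y u v : ℝ, x + x + y + y = u + v →
          (Real.exp x * (c * Real.exp y)) * (Real.exp x * (c * Real.exp y)) =
            (c * Real.exp u) * (c * Real.exp v) := by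
        intro c x y u v h
        have h' : Real.exp x * Real.exp x * Real.exp y * Real.exp y = Real.exp u * Real.exp v := by
          rw [← Real.exp_add, ← Real.exp_add, ← Real.exp_add, ← Real.exp_add, h]
        calc _ = c * c * (Real.exp x * Real.exp x * Real.exp y * Real.exp y) := by ring
          _ = _ := by rw [h']; ring
      refine (e _ _ _ _ _ ?_).symm
      ring
    rw [sub_sq, Real.sq_sqrt ha, Real.sq_sqrt hb, mul_assoc 2, hprod]
    ring
  have hi := fun c => (isProbDensity_gaussianPDFReal c).integrable
  have hab : Integrable (fun z => gaussianPDFReal a 1 z + gaussianPDFReal b 1 z) :=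
    (hi a).add (hi b)
  unfold hellingerSq
  simp only [hpt]
  rw [integral_sub hab ((hi _).const_mul _), integral_add (hi a) (hi b),
    integral_const_mul]
  simp only [(isProbDensity_gaussianPDFReal _).integral_eq_one]
  linarith [Real.add_one_le_exp (-(a - b) ^ 2 / 8)]

theorem hellingerSq_transformedDensity (m : ℕ) (p : unitInterval) (g : ℝ → ℝ) :
    hellingerSq (transformedDensity m p) g = hellingerSq (bandDensity m p) g := by
  unfold hellingerSq
  refine integral_congr_ae ?_
  filter_upwards [transformedDensity_ae_eq m p] with z hz
  simp only [hz]

theorem hellingerSq_bandDensity_zero (p : unitInterval) :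
    hellingerSq (bandDensity 0 p) (gaussianPDFReal 0 1) = 0 := by
  unfold hellingerSq
  rw [integral_eq_zero_of_ae]
  filter_upwards [ae_exists_mem_band 0] with z ⟨k, hk, hz⟩
  obtain rfl : k = 0 := by omega
  rw [bandDensity_of_mem hk p hz]
  simp [binomialRatio]

/-! ### Comparison with the tilted normal law -/

/-- The constant in the comparison of the transformed density with the tilted normal density. -/
noncomputable def tiltConst : ℝ :=
  33 * (10 ^ 14) ^ 2 * (1 + Real.exp 3) * 24577 * (∫ z : ℝ, Real.exp (-z ^ 2 / 16)) + 2 * 10 ^ 32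

theorem integral_exp_nonneg : 0 ≤ ∫ z : ℝ, Real.exp (-z ^ 2 / 16) :=
  integral_nonneg fun _ => (Real.exp_pos _).le

theorem tiltConst_pos : 0 < tiltConst := by
  have := integral_exp_nonneg
  unfold tiltConst
  positivity

theorem hellingerSq_bandDensity_le (m : ℕ) {p : unitInterval} (hp0 : 0 < p) (hp1 : p < 1)
    {t : ℝ} (ht : t = Real.log ((p : ℝ) / (1 - (p : ℝ))) / 2) (hm : 0 < m) :
    hellingerSq (bandDensity m p) (gaussianPDFReal (√m * t) 1) ≤
      tiltConst * (t ^ 2 + m ^ 2 * t ^ 8) := by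
  have hI := integral_exp_nonneg
  have hK : 2 * 10 ^ 32 ≤ tiltConst := by
    unfold tiltConst
    have := mul_nonneg (by positivity : 0 ≤ 33 * (10 ^ 14) ^ 2 * (1 + Real.exp 3) * 24577) hI
    linarith
  have htwo := hellingerSq_le_two (isProbDensity_bandDensity m p)
    (isProbDensity_gaussianPDFReal (√m * t))
  have hx : 0 ≤ t ^ 2 := sq_nonneg t
  have hy : 0 ≤ m ^ 2 * t ^ 8 := by positivity
  -- Outside the small regime one of `10 ^ 16 * |t|`, `10 ^ 16 * (m * t ^ 4)` exceeds `1`; squaring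
  -- gives this hypothesis, and the summand `2 * 10 ^ 32` of `tiltConst` then covers `H² ≤ 2`.
  have htriv : 1 ≤ 10 ^ 32 * (t ^ 2 + m ^ 2 * t ^ 8) →
      hellingerSq (bandDensity m p) (gaussianPDFReal (√m * t) 1) ≤
        tiltConst * (t ^ 2 + m ^ 2 * t ^ 8) := by
    intro h
    have := mul_le_mul_of_nonneg_right hK (add_nonneg hx hy)
    linarith
  by_cases ht1 : 10 ^ 16 * |t| ≤ 1
  swap
  · apply htriv
    have h1 : (1 : ℝ) ^ 2 ≤ (10 ^ 16 * |t|) ^ 2 :=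
      pow_le_pow_left₀ zero_le_one (not_le.1 ht1).le 2
    rw [mul_pow, sq_abs] at h1
    linarith
  by_cases htm : 10 ^ 16 * (m * t ^ 4) ≤ 1
  swap
  · apply htriv
    have h1 : (1 : ℝ) ^ 2 ≤ (10 ^ 16 * (m * t ^ 4)) ^ 2 :=
      pow_le_pow_left₀ zero_le_one (not_le.1 htm).le 2
    have e : (10 ^ 16 * ((m : ℝ) * t ^ 4)) ^ 2 = 10 ^ 32 * (m ^ 2 * t ^ 8) := by ring
    rw [e] at h1
    linarith
  have hint : Integrable (fun z : ℝ => Real.exp (-z ^ 2 / 16)) := by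
    convert integrable_exp_neg_mul_sq (b := 1 / 16) (by norm_num) using 3
    ring
  calc hellingerSq (bandDensity m p) (gaussianPDFReal (√m * t) 1)
      ≤ ∫ z : ℝ, 33 * (10 ^ 14) ^ 2 * (1 + Real.exp 3) * 24577 * (t ^ 2 + m ^ 2 * t ^ 8) *
        Real.exp (-(z - √m * t) ^ 2 / 16) := by
        refine integral_mono_ae ((isProbDensity_bandDensity m p).integrable_hellinger
          (isProbDensity_gaussianPDFReal _)) ((hint.comp_sub_right (√m * t)).const_mul _) ?_
        filter_upwards [ae_exists_mem_band m] with z ⟨k, hk, hz⟩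
        exact sq_sqrt_bandDensity_sub_le hm hk hp0 hp1 ht ht1 htm hz
    _ = 33 * (10 ^ 14) ^ 2 * (1 + Real.exp 3) * 24577 * (∫ z : ℝ, Real.exp (-z ^ 2 / 16)) *
        (t ^ 2 + m ^ 2 * t ^ 8) := by
        rw [integral_const_mul,
          integral_sub_right_eq_self (fun z : ℝ => Real.exp (-z ^ 2 / 16)) (√m * t)]
        ring
    _ ≤ _ := by
        refine mul_le_mul_of_nonneg_right ?_ (add_nonneg hx hy)
        unfold tiltConst
        linarith

/-! ### From the log-odds mean to the linear mean -/

/-- Comparison of `artanh` with the identity near the origin. -/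
theorem half_log_bounds {d t : ℝ} (hd : |d| ≤ 1 / 2)
    (ht : t = Real.log ((1 + d) / (1 - d)) / 2) : |t| ≤ 2 * |d| ∧ |t - d| ≤ 2 * |d| ^ 3 := by
  have key : ∀ d : ℝ, 0 ≤ d → d ≤ 1 / 2 → d ≤ Real.log ((1 + d) / (1 - d)) / 2 ∧
      Real.log ((1 + d) / (1 - d)) / 2 ≤ d + 4 / 3 * d ^ 3 := by
    intro d h0 h1
    have hl := Real.sum_range_le_log_div h0 (by linarith) 1
    have hu := Real.log_div_le_sum_range_add h0 (by linarith) 1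
    simp only [Finset.range_one, Finset.sum_singleton] at hl hu
    norm_num at hl hu
    have h3 : d ^ 3 / (1 - d ^ 2) ≤ 4 / 3 * d ^ 3 := by
      rw [div_le_iff₀ (by nlinarith)]
      have h3 : 0 ≤ d ^ 3 := by positivity
      have h4 : d ^ 2 ≤ 1 / 4 := by nlinarith
      nlinarith [mul_le_mul_of_nonneg_left h4 h3]
    constructor <;> linarith
  have fin : ∀ d t : ℝ, 0 ≤ d → d ≤ 1 / 2 → d ≤ t → t ≤ d + 4 / 3 * d ^ 3 →
      |t| ≤ 2 * |d| ∧ |t - d| ≤ 2 * |d| ^ 3 := by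
    intro d t h0 h1 h2 h3
    rw [abs_of_nonneg h0, abs_of_nonneg (h0.trans h2), abs_of_nonneg (sub_nonneg.2 h2)]
    have h5 : 0 ≤ d ^ 3 := by positivity
    have h4 : d ^ 3 ≤ 1 / 4 * d := by
      have : d ^ 2 ≤ 1 / 4 := by nlinarith
      nlinarith [mul_le_mul_of_nonneg_left this h0]
    constructor <;> linarith
  rcases le_total 0 d with h0 | h0
  · rw [abs_of_nonneg h0] at hd
    obtain ⟨h1, h2⟩ := key d h0 hd
    rw [← ht] at h1 h2
    exact fin d t h0 hd h1 h2
  · rw [abs_of_nonpos h0] at hd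
    obtain ⟨h1, h2⟩ := key (-d) (by linarith) hd
    have e : Real.log ((1 + -d) / (1 - -d)) / 2 = -t := by
      have : (1 + -d) / (1 - -d) = ((1 + d) / (1 - d))⁻¹ := by
        rw [inv_div, ← sub_eq_add_neg, sub_neg_eq_add]
      rw [this, Real.log_inv, ht, neg_div]
    rw [e] at h1 h2
    have h3 := fin (-d) (-t) (by linarith) hd h1 h2
    rwa [abs_neg, abs_neg, show -t - -d = -(t - d) by ring, abs_neg] at h3

/-- If `|d| > 1/2` (which includes `p = 0` and `p = 1`) or `m d⁴ > 1`, the summand `64` covers the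
trivial bound. Otherwise the tilted comparison applies, and moving its mean from `√m t` to `√m d`
costs `m(t - d)² = O(m d⁶)`, absorbed into `m d⁴`. -/
theorem hellingerSq_bandDensity_centered_le (m : ℕ) (p : unitInterval) :
    2 * hellingerSq (bandDensity m p) (gaussianPDFReal (√m * (2 * p - 1)) 1) ≤
      (16384 * tiltConst + 64) *
        (((p : ℝ) - 1 / 2) ^ 2 + m * ((p : ℝ) - 1 / 2) ^ 4) := by
  have hK := tiltConst_pos
  rcases Nat.eq_zero_or_pos m with rfl | hm
  · have := hellingerSq_bandDensity_zero p
    simp only [Nat.cast_zero, Real.sqrt_zero, zero_mul, this, mul_zero, add_zero]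
    positivity
  have hm' : (0 : ℝ) < m := by exact_mod_cast hm
  have hss : √(m : ℝ) ^ 2 = m := Real.sq_sqrt hm'.le
  set d : ℝ := 2 * p - 1 with hd
  have e2 : ((p : ℝ) - 1 / 2) ^ 2 = d ^ 2 / 4 := by rw [hd]; ring
  have e4 : ((p : ℝ) - 1 / 2) ^ 4 = d ^ 4 / 16 := by rw [hd]; ring
  rw [e2, e4]
  have h2 : 0 ≤ d ^ 2 := sq_nonneg d
  have h4 : 0 ≤ m * d ^ 4 := by positivity
  have htwo := hellingerSq_le_two (isProbDensity_bandDensity m p)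
    (isProbDensity_gaussianPDFReal (√m * d))
  have hKx := mul_nonneg hK.le (add_nonneg h2 h4)
  by_cases hd1 : |d| ≤ 1 / 2
  swap
  · have h1 : (1 / 2 : ℝ) ^ 2 ≤ |d| ^ 2 := pow_le_pow_left₀ (by norm_num) (not_le.1 hd1).le 2
    rw [sq_abs] at h1
    nlinarith [mul_nonneg hK.le h2, mul_nonneg hK.le h4]
  by_cases hd2 : m * d ^ 4 ≤ 1
  swap
  · nlinarith [mul_nonneg hK.le h2, mul_nonneg hK.le h4]
  obtain ⟨hda, hdb⟩ := abs_le.1 hd1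
  have hp0 : 0 < p := by
    have : (0 : ℝ) < p := by linarith
    exact this
  have hp1 : p < 1 := by
    have : (p : ℝ) < 1 := by linarith
    exact this
  set t := Real.log ((p : ℝ) / (1 - (p : ℝ))) / 2 with ht
  have ht' : t = Real.log ((1 + d) / (1 - d)) / 2 := by
    rw [ht, hd, show 1 + (2 * (p : ℝ) - 1) = 2 * p by ring,
      show 1 - (2 * (p : ℝ) - 1) = 2 * (1 - p) by ring, mul_div_mul_left _ _ two_ne_zero]
  obtain ⟨hb1, hb2⟩ := half_log_bounds hd1 ht'
  have hmain := hellingerSq_bandDensity_le m hp0 hp1 ht hm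
  have hgauss := hellingerSq_gaussianPDFReal_le (√m * t) (√m * d)
  have htri := hellingerSq_triangle (isProbDensity_bandDensity m p)
    (isProbDensity_gaussianPDFReal (√m * t)) (isProbDensity_gaussianPDFReal (√m * d))
  have ht2 : t ^ 2 ≤ 4 * d ^ 2 := by
    have := pow_le_pow_left₀ (abs_nonneg t) hb1 2
    rw [mul_pow, sq_abs, sq_abs] at this
    linarith
  -- The restriction `m d⁴ ≤ 1` reduces `m² d⁸` to `m d⁴`.
  have ht8 : m ^ 2 * t ^ 8 ≤ 256 * (m * d ^ 4) := by
    have h8 : t ^ 8 ≤ 256 * d ^ 8 := by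
      have := pow_le_pow_left₀ (sq_nonneg t) ht2 4
      linarith
    calc (m : ℝ) ^ 2 * t ^ 8 ≤ m ^ 2 * (256 * d ^ 8) := by gcongr
      _ = 256 * ((m * d ^ 4) * (m * d ^ 4)) := by ring
      _ ≤ 256 * ((m * d ^ 4) * 1) := by gcongr
      _ = _ := by ring
  have hg2 : (√m * t - √m * d) ^ 2 ≤ m * d ^ 4 := by
    have h6 : (t - d) ^ 2 ≤ 4 * (d ^ 2 * d ^ 4) := by
      have := pow_le_pow_left₀ (abs_nonneg _) hb2 2
      rw [sq_abs, mul_pow, ← pow_mul, show 3 * 2 = 2 * 3 from rfl, pow_mul, sq_abs] at this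
      linarith
    have hd4 : d ^ 2 ≤ 1 / 4 := by nlinarith
    have h7 : d ^ 2 * d ^ 4 ≤ 1 / 4 * d ^ 4 := by gcongr
    rw [← mul_sub, mul_pow, hss]
    gcongr
    linarith
  have hfin : tiltConst * (t ^ 2 + m ^ 2 * t ^ 8) ≤
      tiltConst * (4 * d ^ 2 + 256 * (m * d ^ 4)) := by gcongr
  nlinarith [mul_nonneg hK.le h2, mul_nonneg hK.le h4]

theorem theorem5 :
    -- `g̃_{m,p}` is a probability density of `Φ⁻¹(F_m(X + U))`
    (∀ (m : ℕ) (p : unitInterval),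
      Measurable (quantileCoupling m) ∧
      ((binomial m p).prod uniformNoise).map (quantileCoupling m) =
        (volume : Measure ℝ).withDensity
          (fun z => ENNReal.ofReal (transformedDensity m p z))) ∧
    -- comparison with `N(b, 1)`
    (∃ C₁ : ℝ, 0 < C₁ ∧ ∀ (m : ℕ) (p : unitInterval), 0 < p → p < 1 →
      ∀ b : ℝ, b = √(m : ℝ) / 2 * Real.log ((p : ℝ) / (1 - (p : ℝ))) →
        hellingerSq (transformedDensity m p) (gaussianPDFReal b 1) ≤
          C₁ * (b ^ 2 / (m : ℝ) + b ^ 8 / (m : ℝ) ^ 2)) ∧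
    -- comparison with `N(β, 1)`
    (∃ D : ℝ, 0 < D ∧ ∀ (m : ℕ) (p : unitInterval) (β : ℝ),
      hellingerSq (transformedDensity m p) (gaussianPDFReal β 1) ≤
        D * (((p : ℝ) - 1 / 2) ^ 2 + (m : ℝ) * ((p : ℝ) - 1 / 2) ^ 4) +
          (√(m : ℝ) * (2 * (p : ℝ) - 1) - β) ^ 2 / 2) := by
  have hK := tiltConst_pos
  refine ⟨fun m p => ⟨measurable_quantileCoupling m, map_quantileCoupling_eq_withDensity m p⟩,
    ⟨tiltConst, hK, ?_⟩, ⟨16384 * tiltConst + 64, by positivity, ?_⟩⟩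
  · intro m p hp0 hp1 b hb
    rw [hellingerSq_transformedDensity]
    rcases Nat.eq_zero_or_pos m with rfl | hm
    · have hb0 : b = 0 := by simp [hb]
      rw [hb0, hellingerSq_bandDensity_zero]
      simp
    have hm' : (0 : ℝ) < m := by exact_mod_cast hm
    have hss : √(m : ℝ) ^ 2 = m := Real.sq_sqrt hm'.le
    set t := Real.log ((p : ℝ) / (1 - (p : ℝ))) / 2 with ht
    have hbt : b = √m * t := by rw [hb, ht]; ring
    have h1 := hellingerSq_bandDensity_le m hp0 hp1 ht hm
    have e2 : b ^ 2 / (m : ℝ) = t ^ 2 := by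
      rw [hbt, mul_pow, hss, mul_div_cancel_left₀ _ hm'.ne']
    have e8 : b ^ 8 / (m : ℝ) ^ 2 = m ^ 2 * t ^ 8 := by
      have : √(m : ℝ) ^ 8 = m ^ 4 := by
        rw [show 8 = 2 * 4 from rfl, pow_mul, hss]
      rw [hbt, mul_pow, this]
      field_simp
    rw [e2, e8, hbt]
    exact h1
  · intro m p β
    rw [hellingerSq_transformedDensity]
    have h1 := hellingerSq_triangle (isProbDensity_bandDensity m p)
      (isProbDensity_gaussianPDFReal (√m * (2 * p - 1))) (isProbDensity_gaussianPDFReal β)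
    have h2 := hellingerSq_bandDensity_centered_le m p
    -- The triangle inequality doubles the coefficient `1/4`, giving the final `1/2`.
    have h3 := hellingerSq_gaussianPDFReal_le (√m * (2 * p - 1)) β
    linarith
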